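/- Let $\lambda>0$, $k=2\pi/\lambda$, and $G(\mathbf v)=e^{-jk|\mathbf v|}/|\mathbf v|$ for $\mathbf v\in\mathbb R^3\setminus\{0\}$. A reconfigurable intelligent surface lies in the plane $z=0$ with unit normal $\mathbf n=(0,0,1)$. Its element with indices $1\le m\le M$, $1\le n\le N$ is the $a\times b$ rectangle $S_{mn}$ (with $a,b>0$) in this plane centred at $\left(\frac{2m-M-1}{2}a,\frac{2n-N-1}{2}b,0\right)$. The transmitter $\mathrm T$ and the receiver $\mathrm R$ lie in $z>0$. For a point $P$ of the plane put $\mathbf r^i=P-\mathrm T$, $\mathbf r^r=\mathrm R-P$, $r^i=|\mathbf r^i|$, $r^r=|\mathbf r^r|$, and let $\cos(\mathbf r,\mathbf n)$ be the cosine of the angle between $\mathbf r$ and $\mathbf n$. Let $\Gamma,A\in\mathbb C$ be the reflection coefficient and the field intensity of the element. The incident field is $E_{inc}(x)=A\,G(x-\mathrm T)$, and the reflected wave is $W(x)=\Gamma E_{inc}(\bar x)$, where $\bar x$ is the mirror image of $x$ in the plane $z=0$. For $\rho>0$ consider the closed surface consisting of the disc of radius $\rho$ about the origin in the plane $z=0$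 and the hemisphere $|x|=\rho$, $z>0$. Let $\nu$ be its outward unit normal and $g(x)=G(x-\mathrm R)$. A field is called radiating if, in $z>0$, it is differentiable, it is $O(1/r)$, and $r\left(\partial_r U+jkU\right)\to0$ uniformly in all directions as $r=|x|\to\infty$. (1) (Helmholtz–Kirchhoff) If $U$ is $C^2$ at every point of the closed half-space $z\ge0$ and solves $\Delta U+k^2U=0$ there, then for every $\rho>|\mathrm R|$ for which the disc contains $S_{mn}$, $$U(\mathrm R)=\frac1{4\pi}\oint\left[\frac{\partial U}{\partial\nu}\,g-U\,\frac{\partial g}{\partial\nu}\right]d\sigma .$$ The reflected wave $W$ is such a field, it is radiating, and $W=\Gamma E_{inc}$ on the plane $z=0$. (2) Consider the integral in (1) with the field $W$ on $S_{mn}$, the zero field on the rest of the disc, and any radiating field on the hemisphere. As $\rho\to\infty$ it converges to a limit $E^r_{mn}$, the field reflected by $S_{mn}$, which does not depend on the radiating field: $$E^r_{mn}=\frac1{4\pi}\iint_{S_{mn}}\left[\frac{\partial W}{\partial\nu}\,g-W\,\frac{\partial g}{\partial\nu}\right]d\sigma .$$ Moreover, exactly, $$E^r_{mn}=\frac{\Gamma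 A}{4\pi}\iint_{S_{mn}}G(\mathbf r^i)G(\mathbf r^r)\left[\left(jk+\tfrac1{r^r}\right)\cos(\mathbf r^r,\mathbf n)-\left(jk+\tfrac1{r^i}\right)\cos(\mathbf r^i,\mathbf n)\right]d\sigma .$$ (3) In the regime $1/r\ll k$, $$E^r_{mn}\approx\frac{jk\Gamma A}{4\pi}\iint_{S_{mn}}G(\mathbf r^i)G(\mathbf r^r)\left[\cos(\mathbf r^r,\mathbf n)-\cos(\mathbf r^i,\mathbf n)\right]d\sigma$$ in the following precise sense: if $1/r^i\le\varepsilon k$ and $1/r^r\le\varepsilon k$ at every point of $S_{mn}$, then the two sides differ in modulus by at most $$\varepsilon\cdot\frac{k|\Gamma||A|}{4\pi}\iint_{S_{mn}}\Bigl|G(\mathbf r^i)G(\mathbf r^r)\left[\cos(\mathbf r^r,\mathbf n)-\cos(\mathbf r^i,\mathbf n)\right]\Bigr|\,d\sigma .$$ -/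

import Mathlib

noncomputable section

namespace RIS

/-- Three-dimensional Euclidean space with Cartesian coordinates `x 0, x 1, x 2`. -/
abbrev Space : Type := EuclideanSpace ℝ (Fin 3)

/-- The Green function `G(v) = exp (-j k r) / r`, where `r = |v|`. -/
def green (k : ℝ) (v : Space) : ℂ :=
  Complex.exp (-(Complex.I * k * ‖v‖)) / ‖v‖

/-- The unit normal `n` of the surface, which lies in the plane `z = 0` and faces the half-space
`z > 0` of the transmitter and the receiver. -/
def normal : Space := !₂[(0 : ℝ), 0, 1]

/-- Cosine of the angle between the vector `v` and the normal `n`. -/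
def cosNormal (v : Space) : ℝ := Real.cos (InnerProductGeometry.angle v normal)

/-- The point `(x, y, 0)` of the plane of the surface. -/
def planePoint (p : ℝ × ℝ) : Space := !₂[p.1, p.2, 0]

/-- The vector from the transmitter `T` to the point `(x, y, 0)`. -/
def incVec (T : Space) (p : ℝ × ℝ) : Space := planePoint p - T

/-- The vector from the point `(x, y, 0)` to the receiver `R`. -/
def refVec (R : Space) (p : ℝ × ℝ) : Space := R - planePoint p

/-- The patch of the element with indices `m`, `n`: the `a × b` rectangle centred at
`(((2 m - M - 1) / 2) a, ((2 n - N - 1) / 2) b)`, in the coordinates `(x, y)` of the plane. -/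
def patch (a b : ℝ) (M N m n : ℕ) : Set (ℝ × ℝ) :=
  Set.Icc ((2 * (m : ℝ) - M - 1) / 2 * a - a / 2) ((2 * (m : ℝ) - M - 1) / 2 * a + a / 2) ×ˢ
    Set.Icc ((2 * (n : ℝ) - N - 1) / 2 * b - b / 2) ((2 * (n : ℝ) - N - 1) / 2 * b + b / 2)

/-- The wave radiated by the transmitter at `T`, with intensity `A`. -/
def incidentWave (k : ℝ) (T : Space) (A : ℂ) (x : Space) : ℂ := A * green k (x - T)

/-- Mirror image in the plane `z = 0`. -/
def mirror (x : Space) : Space := !₂[x 0, x 1, -(x 2)]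

/-- The wave into which the plane `z = 0`, with reflection coefficient `Γ`, turns the incident
wave: it travels back into `z > 0`, and on the plane it is `Γ` times the incident wave. -/
def reflectedWave (k : ℝ) (T : Space) (Γ A : ℂ) (x : Space) : ℂ :=
  Γ * incidentWave k T A (mirror x)

/-- `U` is twice continuously differentiable on the closed half-space `z ≥ 0` and solves the
Helmholtz equation `Δ U + k² U = 0` there. -/
def IsHelmholtz (k : ℝ) (U : Space → ℂ) : Prop :=
  ∀ x : Space, 0 ≤ x 2 → ContDiffAt ℝ 2 U x ∧ Laplacian.laplacian U x + (k : ℂ) ^ 2 * U x = 0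

/-- Sommerfeld's conditions at infinity in the half-space `z > 0`, for the time convention in
which `exp (-j k r) / r` is outgoing: `U` is differentiable, `U = O(1/r)`, and
`r (∂U/∂r + j k U) → 0` uniformly in all directions. -/
def IsRadiating (k : ℝ) (U : Space → ℂ) : Prop :=
  (∀ x : Space, 0 < x 2 → DifferentiableAt ℝ U x) ∧
  (∃ C r₀ : ℝ, ∀ x : Space, 0 < x 2 → r₀ ≤ ‖x‖ → ‖U x‖ ≤ C / ‖x‖) ∧
  (∀ ε : ℝ, 0 < ε → ∃ r₀ : ℝ, ∀ x : Space, 0 < x 2 → r₀ ≤ ‖x‖ →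
    ‖x‖ * ‖fderiv ℝ U x (‖x‖⁻¹ • x) + Complex.I * k * U x‖ ≤ ε)

/-- The Helmholtz–Kirchhoff integrand `(∂U/∂ν) g - U (∂g/∂ν)` at the point `x` of a surface with
outward unit normal `ν`, where `g y = G (y - R)` and `R` is the observation point. -/
def hkDensity (k : ℝ) (R : Space) (U : Space → ℂ) (x ν : Space) : ℂ :=
  fderiv ℝ U x ν * green k (x - R) - U x * fderiv ℝ (fun y => green k (y - R)) x ν

/-- Surface integral over a region `D` of the plane `z = 0`, with outward normal `-n`. -/
def flatFlux (k : ℝ) (R : Space) (U : Space → ℂ) (D : Set (ℝ × ℝ)) : ℂ :=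
  ∫ p in D, hkDensity k R U (planePoint p) (-normal)

/-- Surface integral over the hemisphere `|x| = ρ`, `z > 0`. -/
def capFlux (k : ℝ) (R : Space) (U : Space → ℂ) (ρ : ℝ) : ℂ :=
  (ρ : ℂ) ^ 2 * ∫ ω in {ω : Metric.sphere (0 : Space) 1 | 0 < (ω : Space) 2},
    hkDensity k R U (ρ • (ω : Space)) (ω : Space)
      ∂((MeasureTheory.volume : MeasureTheory.Measure Space).toSphere)

/-- The disc of radius `ρ` in the plane `z = 0`. -/
def disc (ρ : ℝ) : Set (ℝ × ℝ) := {p | p.1 ^ 2 + p.2 ^ 2 ≤ ρ ^ 2}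

/-- The Helmholtz–Kirchhoff integral `(1/4π) ∯ [(∂E/∂ν) g - E (∂g/∂ν)] dσ` over the closed
surface made of the patch `S`, the rest of the disc of radius `ρ`, and the hemisphere of radius
`ρ`. The field `E` is `ES` on `S`, `EF` on the rest of the disc, and `EH` on the hemisphere. -/
def hkIntegral (k : ℝ) (R : Space) (S : Set (ℝ × ℝ)) (ES EF EH : Space → ℂ) (ρ : ℝ) : ℂ :=
  1 / (4 * (Real.pi : ℂ)) *
    (flatFlux k R ES S + flatFlux k R EF (disc ρ \ S) + capFlux k R EH ρ)

end RIS

end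

noncomputable section

namespace RIS

open MeasureTheory Set Filter Topology Metric
open scoped RealInnerProductSpace Manifold

/-! ### Integration in polar coordinates. -/

section Polar

variable {E F : Type*} [NormedAddCommGroup E] [NormedSpace ℝ E] [FiniteDimensional ℝ E]
  [Nontrivial E] [MeasurableSpace E] [BorelSpace E] [NormedAddCommGroup F] [NormedSpace ℝ F]

/-! Write `g` for the Green function centred at the receiver `R`. If `U` solves the Helmholtz
equation, the field `F = g ∇U - U ∇g` is divergence-free away from `R`, and `hkDensity` is its
component along `ν`. Its flux through the boundary of a half-ball therefore equals its flux through
a small sphere about `R`, which tends to `4π U(R)` because `g` behaves like `1/r`.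

The surface form of this argument is obtained from volume integrals. A cut-off `χ` equals `1` on the
half-ball outside a small ball about `R`, and drops to `0` in a thin shell outside radius `ρ` and in
a thin shell around `R`. On the half-space, the divergence theorem for the compactly supported field
`χ F` gives `∫ ∇χ · F = -∫ χ F_z` over the plane (`setIntegral_upperSpace_hkDensity_gradient`). In
polar coordinates the two parts of `∇χ` turn the left side into averages of `capFlux` over radii
near `ρ` and of `sphereFlux` over radii near `0` (`IsThin.weighted_identity`). Letting the thickness
tend to zero yields `flatFlux_add_capFlux`. A field known to be regular only on `z ≥ 0` is first
replaced by a global `C²` function (`exists_contDiff_extension`).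

The reflected wave is a point source at the mirror image of `T`, which lies below the plane, so it
is regular on `z ≥ 0` and radiating. For a radiating field the density on the hemisphere is
`o(1/ρ²)`, so the cap contributes nothing in the limit and only the integral over the patch remains.
The exact formula is then the gradient of the Green function evaluated on the plane. In the
far-field estimate the two cosines have opposite signs, so the dropped terms add without
cancellation and are at most `ε k` times the kept ones, pointwise. -/

theorem integrableOn_and_integral_polar (μ : Measure E) [μ.IsAddHaarMeasure] {f : E → F}
    (hf : Integrable f μ) :
    IntegrableOn (fun r : ℝ => r ^ (Module.finrank ℝ E - 1) •
      ∫ ω : sphere (0 : E) 1, f (r • (ω : E)) ∂μ.toSphere) (Ioi 0) ∧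
    ∫ x, f x ∂μ = ∫ r in Ioi (0 : ℝ), r ^ (Module.finrank ℝ E - 1) •
      ∫ ω : sphere (0 : E) 1, f (r • (ω : E)) ∂μ.toSphere := by
  set d := Module.finrank ℝ E - 1
  set g : sphere (0 : E) 1 × Ioi (0 : ℝ) → F := fun p => f ((p.2 : ℝ) • (p.1 : E))
  have hg : ∀ x : ({0}ᶜ : Set E), g (homeomorphUnitSphereProd E x) = f x := by
    intro x
    have hx : ‖(x : E)‖ ≠ 0 := norm_ne_zero_iff.2 x.2
    simp [g, smul_smul, hx]
  have hmp := μ.measurePreserving_homeomorphUnitSphereProd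
  have hemb := (homeomorphUnitSphereProd E).measurableEmbedding
  have hgi : Integrable g (μ.toSphere.prod (Measure.volumeIoiPow d)) := by
    rw [← hmp.integrable_comp_emb hemb]
    have : g ∘ homeomorphUnitSphereProd E = f ∘ Subtype.val := funext hg
    rw [this, ← integrableOn_iff_comap_subtypeVal (measurableSet_singleton _).compl]
    exact hf.integrableOn
  have hmeas : Measurable fun r : Ioi (0 : ℝ) => Real.toNNReal ((r : ℝ) ^ d) :=
    (measurable_subtype_coe.pow_const _).real_toNNReal
  have hI : Integrable (fun r : Ioi (0 : ℝ) => ∫ ω, g (ω, r) ∂μ.toSphere)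
      (Measure.volumeIoiPow d) := hgi.integral_prod_right
  constructor
  · rw [integrableOn_iff_comap_subtypeVal measurableSet_Ioi]
    rw [Measure.volumeIoiPow] at hI
    have h2 := (integrable_withDensity_iff_integrable_smul (μ := Measure.comap Subtype.val volume)
      hmeas (g := fun r : Ioi (0 : ℝ) => ∫ ω, g (ω, r) ∂μ.toSphere)).1 hI
    refine h2.congr (Eventually.of_forall fun r => ?_)
    simp only [Function.comp, NNReal.smul_def, g]
    rw [Real.coe_toNNReal _ (pow_nonneg r.2.out.le _)]
  · calc ∫ x, f x ∂μ = ∫ x : ({(0)}ᶜ : Set E), f x ∂(μ.comap (↑)) := by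
          rw [integral_subtype_comap (measurableSet_singleton _).compl f, restrict_compl_singleton]
      _ = ∫ p, g p ∂(μ.toSphere.prod (Measure.volumeIoiPow d)) := by
          rw [← hmp.integral_comp hemb]
          exact integral_congr_ae (Eventually.of_forall fun x => (hg x).symm)
      _ = ∫ r, ∫ ω, g (ω, r) ∂μ.toSphere ∂(Measure.volumeIoiPow d) :=
          integral_prod_symm _ hgi
      _ = _ := by
          simp only [Measure.volumeIoiPow, ENNReal.ofReal]
          rw [integral_withDensity_eq_integral_smul hmeas]
          rw [← integral_subtype_comap measurableSet_Ioi fun r : ℝ => r ^ d •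
            ∫ ω : sphere (0 : E) 1, f (r • (ω : E)) ∂μ.toSphere]
          refine integral_congr_ae (Eventually.of_forall fun r => ?_)
          simp only [NNReal.smul_def, g]
          rw [Real.coe_toNNReal _ (pow_nonneg r.2.out.le _)]

end Polar

/-- The open half-space `z > 0`. -/
def upperSpace : Set Space := {x | 0 < x 2}

/-- The open upper half of the unit sphere. -/
def upperSphere : Set (sphere (0 : Space) 1) := {ω | 0 < (ω : Space) 2}

theorem isOpen_upperSpace : IsOpen upperSpace :=
  isOpen_lt continuous_const (by fun_prop)

theorem measurableSet_upperSphere : MeasurableSet upperSphere :=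
  (isOpen_lt continuous_const (by fun_prop) : IsOpen upperSphere).measurableSet

/-- The half-space is a cone, so at each positive radius its indicator depends on the direction
alone. -/
theorem integrableOn_and_integral_polar_upperSpace {f : Space → ℂ}
    (hf : IntegrableOn f upperSpace) :
    IntegrableOn (fun r : ℝ => r ^ 2 •
      ∫ ω in upperSphere, f (r • (ω : Space)) ∂(volume : Measure Space).toSphere) (Ioi 0) ∧
    ∫ x in upperSpace, f x = ∫ r in Ioi (0 : ℝ), r ^ 2 •
      ∫ ω in upperSphere, f (r • (ω : Space)) ∂(volume : Measure Space).toSphere := by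
  have h := integrableOn_and_integral_polar volume
    ((integrable_indicator_iff isOpen_upperSpace.measurableSet).2 hf)
  simp only [finrank_euclideanSpace, Fintype.card_fin, Nat.add_one_sub_one] at h
  rw [integral_indicator isOpen_upperSpace.measurableSet] at h
  have key : ∀ r ∈ Ioi (0 : ℝ), r ^ 2 • ∫ ω : sphere (0 : Space) 1,
      upperSpace.indicator f (r • (ω : Space)) ∂(volume : Measure Space).toSphere = r ^ 2 •
      ∫ ω in upperSphere, f (r • (ω : Space)) ∂(volume : Measure Space).toSphere := by
    intro r hr
    rw [← integral_indicator measurableSet_upperSphere]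
    congr 2
    ext ω
    have hiff : r • (ω : Space) ∈ upperSpace ↔ ω ∈ upperSphere := by
      simp only [upperSpace, upperSphere, mem_ofPred_eq, PiLp.smul_apply, smul_eq_mul,
        mul_pos_iff_of_pos_left hr.out]
    by_cases hω : ω ∈ upperSphere
    · rw [indicator_of_mem hω, indicator_of_mem (hiff.2 hω)]
    · rw [indicator_of_notMem hω, indicator_of_notMem (mt hiff.1 hω)]
  rwa [setIntegral_congr_fun measurableSet_Ioi key,
    integrableOn_congr_fun key measurableSet_Ioi] at h

/-! ### The divergence theorem on the half-space for compactly supported fields. -/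

/-- The point whose `i`-th coordinate is `t` and whose other coordinates are those of `q`. -/
def insertCoord (i : Fin 3) (t : ℝ) (q : Fin 2 → ℝ) : Space :=
  WithLp.toLp 2 (i.insertNth t q)

theorem insertCoord_same (i : Fin 3) (t : ℝ) (q : Fin 2 → ℝ) : insertCoord i t q i = t := by
  simp [insertCoord]

theorem measurePreserving_insertCoord (i : Fin 3) :
    MeasurePreserving (fun p : ℝ × (Fin 2 → ℝ) => insertCoord i p.1 p.2) :=
  (PiLp.volume_preserving_toLp (Fin 3)).comp
    ((volume_preserving_piFinSuccAbove (fun _ : Fin 3 => ℝ) i).symm _)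

theorem measurableEmbedding_insertCoord (i : Fin 3) :
    MeasurableEmbedding (fun p : ℝ × (Fin 2 → ℝ) => insertCoord i p.1 p.2) :=
  (MeasurableEquiv.toLp 2 (Fin 3 → ℝ)).measurableEmbedding.comp
    (MeasurableEquiv.piFinSuccAbove (fun _ : Fin 3 => ℝ) i).symm.measurableEmbedding

theorem integral_eq_iterated_insertCoord (i : Fin 3) {f : Space → ℂ} (hf : Integrable f) :
    ∫ x, f x = ∫ q : Fin 2 → ℝ, ∫ t : ℝ, f (insertCoord i t q) := by
  have hmp := measurePreserving_insertCoord i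
  have hemb := measurableEmbedding_insertCoord i
  rw [← hmp.integral_comp hemb]
  exact integral_prod_symm _ ((hmp.integrable_comp_emb hemb).2 hf)

/-- The `i`-th vector of the standard basis. -/
def basisVec (i : Fin 3) : Space := EuclideanSpace.single i 1

theorem insertCoord_eq (i : Fin 3) (t : ℝ) (q : Fin 2 → ℝ) :
    insertCoord i t q = insertCoord i 0 q + t • basisVec i := by
  ext j
  refine i.succAboveCases ?_ (fun j => ?_) j
  · simp [insertCoord, basisVec]
  · simp [insertCoord, basisVec, Fin.succAbove_ne]

theorem hasDerivAt_comp_insertCoord {f : Space → ℂ} (hf : ContDiff ℝ 1 f) (i : Fin 3)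
    (q : Fin 2 → ℝ) (t : ℝ) :
    HasDerivAt (fun t => f (insertCoord i t q)) (fderiv ℝ f (insertCoord i t q) (basisVec i)) t := by
  have h1 : HasDerivAt (fun t => insertCoord i t q) (basisVec i) t := by
    have : (fun t => insertCoord i t q) = fun t => insertCoord i 0 q + t • basisVec i :=
      funext fun t => insertCoord_eq i t q
    rw [this]
    simpa using ((hasDerivAt_id t).smul_const (basisVec i)).const_add (insertCoord i 0 q)
  exact ((hf.differentiable one_ne_zero).differentiableAt.hasFDerivAt).comp_hasDerivAt t h1

theorem contDiff_comp_insertCoord {f : Space → ℂ} (hf : ContDiff ℝ 1 f) (i : Fin 3)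
    (q : Fin 2 → ℝ) : ContDiff ℝ 1 (fun t => f (insertCoord i t q)) := by
  have : (fun t => insertCoord i t q) = fun t => insertCoord i 0 q + t • basisVec i :=
    funext fun t => insertCoord_eq i t q
  exact hf.comp (this ▸ by fun_prop)

theorem hasCompactSupport_comp_insertCoord {f : Space → ℂ} (hf : HasCompactSupport f) (i : Fin 3)
    (q : Fin 2 → ℝ) : HasCompactSupport (fun t => f (insertCoord i t q)) := by
  obtain ⟨C, hC⟩ := hf.isCompact.isBounded.exists_norm_le
  refine HasCompactSupport.intro (isCompact_closedBall (0 : ℝ) C) fun t ht => ?_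
  by_contra h
  have h1 := hC _ (subset_tsupport _ h)
  have h2 := PiLp.norm_apply_le (insertCoord i t q) i
  rw [insertCoord_same] at h2
  simp only [mem_closedBall, dist_zero_right, not_le] at ht
  linarith

theorem integrable_fderiv_apply {f : Space → ℂ} (hf : ContDiff ℝ 1 f) (hc : HasCompactSupport f)
    (v : Space) : Integrable fun x => fderiv ℝ f x v :=
  ((hf.continuous_fderiv one_ne_zero).clm_apply continuous_const).integrable_of_hasCompactSupport
    (hc.fderiv_apply (𝕜 := ℝ) v)

theorem setIntegral_upperSpace_fderiv_of_ne {f : Space → ℂ} (hf : ContDiff ℝ 1 f)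
    (hc : HasCompactSupport f) {i : Fin 3} (hi : i ≠ 2) :
    ∫ x in upperSpace, fderiv ℝ f x (basisVec i) = 0 := by
  rw [← integral_indicator isOpen_upperSpace.measurableSet, integral_eq_iterated_insertCoord i
    ((integrable_fderiv_apply hf hc _).indicator isOpen_upperSpace.measurableSet)]
  refine integral_eq_zero_of_ae (Eventually.of_forall fun q => ?_)
  obtain ⟨j, hj⟩ := Fin.exists_succAbove_eq hi.symm
  -- A line in a horizontal direction lies entirely inside or entirely outside the half-space, so
  -- the derivative is integrated over a whole line or not at all.
  have hmem : ∀ t, insertCoord i t q ∈ upperSpace ↔ 0 < q j := by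
    intro t
    simp [insertCoord, upperSpace, ← hj]
  by_cases hq : 0 < q j
  · simp only [indicator, hmem, hq, if_true, Pi.zero_apply]
    refine integral_eq_zero_of_hasDerivAt_of_integrable
      (fun t => hasDerivAt_comp_insertCoord hf i q t) ?_ ?_
    · have : Integrable (deriv fun t => f (insertCoord i t q)) :=
        ((contDiff_comp_insertCoord hf i q).continuous_deriv_one).integrable_of_hasCompactSupport
          (hasCompactSupport_comp_insertCoord hc i q).deriv
      exact this.congr (Eventually.of_forall fun t => (hasDerivAt_comp_insertCoord hf i q t).deriv)
    · exact (contDiff_comp_insertCoord hf i q).continuous.integrable_of_hasCompactSupport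
        (hasCompactSupport_comp_insertCoord hc i q)
  · simp [indicator, hmem, hq]

/-- On each vertical line the fundamental theorem of calculus on `(0, ∞)` leaves only the boundary
value at height `0`. -/
theorem setIntegral_upperSpace_fderiv_normal {f : Space → ℂ} (hf : ContDiff ℝ 1 f)
    (hc : HasCompactSupport f) :
    ∫ x in upperSpace, fderiv ℝ f x (basisVec 2) = -∫ p : ℝ × ℝ, f (planePoint p) := by
  rw [← integral_indicator isOpen_upperSpace.measurableSet, integral_eq_iterated_insertCoord 2
    ((integrable_fderiv_apply hf hc _).indicator isOpen_upperSpace.measurableSet)]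
  have key : ∀ q, ∫ t : ℝ, upperSpace.indicator (fun x => fderiv ℝ f x (basisVec 2))
      (insertCoord 2 t q) = -f (insertCoord 2 0 q) := by
    intro q
    rw [← (hasCompactSupport_comp_insertCoord hc 2 q).integral_Ioi_deriv_eq
      (contDiff_comp_insertCoord hf 2 q) 0, ← integral_indicator measurableSet_Ioi]
    congr 1
    ext t
    simp only [indicator, upperSpace, mem_ofPred_eq, insertCoord_same, mem_Ioi,
      (hasDerivAt_comp_insertCoord hf 2 q t).deriv]
  simp_rw [key]
  rw [integral_neg, ← (volume_preserving_finTwoArrow ℝ).integral_comp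
    (MeasurableEquiv.finTwoArrow).measurableEmbedding]
  congr 2
  ext q
  congr 1
  ext j
  fin_cases j <;> simp [planePoint, insertCoord] <;> rfl

theorem setIntegral_upperSpace_divergence {f : Fin 3 → Space → ℂ} (hf : ∀ i, ContDiff ℝ 1 (f i))
    (hc : ∀ i, HasCompactSupport (f i)) :
    ∫ x in upperSpace, ∑ i, fderiv ℝ (f i) x (basisVec i) = -∫ p : ℝ × ℝ, f 2 (planePoint p) := by
  rw [integral_finsetSum _ fun i _ => (integrable_fderiv_apply (hf i) (hc i) _).integrableOn,
    Fin.sum_univ_three, setIntegral_upperSpace_fderiv_of_ne (hf 0) (hc 0) (by decide),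
    setIntegral_upperSpace_fderiv_of_ne (hf 1) (hc 1) (by decide),
    setIntegral_upperSpace_fderiv_normal (hf 2) (hc 2)]
  simp

/-! ### Derivatives of the Green function. -/

theorem laplacian_eq_sum_fderiv {U : Space → ℂ} {x : Space} (hU : ContDiffAt ℝ 2 U x) :
    Laplacian.laplacian U x =
      ∑ i, fderiv ℝ (fun y => fderiv ℝ U y (basisVec i)) x (basisVec i) := by
  rw [InnerProductSpace.laplacian_eq_iteratedFDeriv_orthonormalBasis U
    (EuclideanSpace.basisFun (Fin 3) ℝ)]
  refine Finset.sum_congr rfl fun i _ => ?_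
  have hd : DifferentiableAt ℝ (fderiv ℝ U) x :=
    (hU.fderiv_right (m := 1) (by norm_num)).differentiableAt one_ne_zero
  rw [iteratedFDeriv_two_apply, fderiv_clm_apply hd (differentiableAt_const _)]
  simp [basisVec]

/-- The gradient of the Green function at `v` is `gradCoeff k ‖v‖ • v`. -/
def gradCoeff (k r : ℝ) : ℂ :=
  -(Complex.I * k * r + 1) * Complex.exp (-(Complex.I * k * r)) / r ^ 3

theorem hasFDerivAt_norm {v : Space} (hv : v ≠ 0) :
    HasFDerivAt (fun x : Space => ‖x‖) (‖v‖⁻¹ • innerSL ℝ v) v := by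
  have h := (hasStrictFDerivAt_norm_sq v).hasFDerivAt.sqrt (by simpa using hv)
  simp only [Real.sqrt_sq (norm_nonneg _)] at h
  refine h.congr_fderiv ?_
  ext w
  simp
  field_simp

theorem hasDerivAt_exp_phase (k r : ℝ) :
    HasDerivAt (fun s : ℝ => Complex.exp (-(Complex.I * k * s)))
      (-(Complex.I * k) * Complex.exp (-(Complex.I * k * r))) r := by
  have h : HasDerivAt (fun s : ℝ => -(Complex.I * k * (s : ℂ))) (-(Complex.I * k)) r := by
    simpa using ((Complex.ofRealCLM.hasDerivAt (x := r)).const_mul (Complex.I * k)).fun_neg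
  refine h.cexp.congr_deriv ?_
  ring

theorem hasFDerivAt_green (k : ℝ) {v : Space} (hv : v ≠ 0) :
    HasFDerivAt (green k) ((innerSL ℝ v).smulRight (gradCoeff k ‖v‖)) v := by
  have hr : (‖v‖ : ℂ) ≠ 0 := by simpa using hv
  have h1 : HasDerivAt (fun s : ℝ => Complex.exp (-(Complex.I * k * s)) / (s : ℂ))
      (gradCoeff k ‖v‖ * ‖v‖) ‖v‖ := by
    refine ((hasDerivAt_exp_phase k ‖v‖).fun_div
      (Complex.ofRealCLM.hasDerivAt (x := ‖v‖)) hr).congr_deriv ?_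
    simp only [gradCoeff, Complex.ofRealCLM_apply, Complex.ofReal_one]
    field_simp
    ring
  refine (h1.hasFDerivAt.comp v (hasFDerivAt_norm hv)).congr_fderiv ?_
  ext w
  simp
  field_simp

theorem fderiv_green_apply (k : ℝ) {v : Space} (hv : v ≠ 0) (w : Space) :
    fderiv ℝ (green k) v w = gradCoeff k ‖v‖ * (⟪v, w⟫ : ℝ) := by
  rw [(hasFDerivAt_green k hv).fderiv]
  simp [mul_comm]

theorem fderiv_green_sub (k : ℝ) (R x : Space) :
    fderiv ℝ (fun y => green k (y - R)) x = fderiv ℝ (green k) (x - R) :=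
  fderiv_comp_sub R

theorem contDiffAt_green (k : ℝ) {n : WithTop ℕ∞} {v : Space} (hv : v ≠ 0) :
    ContDiffAt ℝ n (green k) v := by
  have h : ContDiffAt ℝ n (fun x : Space => ((‖x‖ : ℝ) : ℂ)) v :=
    Complex.ofRealCLM.contDiff.contDiffAt.comp v (contDiffAt_id.norm ℝ hv)
  have hne : ((‖v‖ : ℝ) : ℂ) ≠ 0 := by simpa using hv
  have hgreen : green k = fun x : Space =>
      Complex.exp (-(Complex.I * k * ‖x‖)) * ((‖x‖ : ℝ) : ℂ)⁻¹ :=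
    funext fun x => div_eq_mul_inv _ _
  rw [hgreen]
  exact (contDiffAt_const.mul h).neg.cexp.mul (h.inv hne)

theorem contDiffAt_green_sub (k : ℝ) {n : WithTop ℕ∞} {R x : Space} (hx : x ≠ R) :
    ContDiffAt ℝ n (fun y => green k (y - R)) x :=
  (contDiffAt_green k (sub_ne_zero.2 hx)).comp x (contDiffAt_id.sub contDiffAt_const)

theorem hasDerivAt_gradCoeff (k : ℝ) {r : ℝ} (hr : r ≠ 0) :
    HasDerivAt (gradCoeff k)
      ((((Complex.I * k) ^ 2 * r ^ 2 + 3 * (Complex.I * k * r + 1)) / r ^ 4) *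
        Complex.exp (-(Complex.I * k * r))) r := by
  have hr' : (r : ℂ) ≠ 0 := by exact_mod_cast hr
  have hid := Complex.ofRealCLM.hasDerivAt (x := r)
  simp only [Complex.ofRealCLM_apply, Complex.ofReal_one] at hid
  have hid' : Complex.ofRealCLM r = (r : ℂ) := rfl
  refine (((((hid.const_mul (Complex.I * k)).add_const 1).fun_neg).fun_mul
    (hasDerivAt_exp_phase k r)).fun_div (hid.fun_pow 3) (pow_ne_zero 3 hr')).congr_deriv ?_
  rw [hid']
  field_simp
  ring

/-- The gradient is `c(r) v` with `c = gradCoeff k`, so the Laplacian is `r c'(r) + 3 c(r)`; the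
terms without `k²` cancel. -/
theorem laplacian_green (k : ℝ) {v : Space} (hv : v ≠ 0) :
    Laplacian.laplacian (green k) v = -(k : ℂ) ^ 2 * green k v := by
  rw [laplacian_eq_sum_fderiv (contDiffAt_green k hv)]
  have hr : ‖v‖ ≠ 0 := norm_ne_zero_iff.2 hv
  have hr' : (‖v‖ : ℂ) ≠ 0 := by exact_mod_cast hr
  set c' := ((((Complex.I * k) ^ 2 * ‖v‖ ^ 2 + 3 * (Complex.I * k * ‖v‖ + 1)) / ‖v‖ ^ 4) *
        Complex.exp (-(Complex.I * k * ‖v‖)))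
  have key : ∀ i, fderiv ℝ (fun y => fderiv ℝ (green k) y (basisVec i)) v (basisVec i) =
      c' / ‖v‖ * (v i : ℂ) ^ 2 + gradCoeff k ‖v‖ := by
    intro i
    have heq : (fun y => fderiv ℝ (green k) y (basisVec i)) =ᶠ[𝓝 v]
        fun y => gradCoeff k ‖y‖ * ((y i : ℝ) : ℂ) := by
      filter_upwards [isOpen_ne.mem_nhds hv] with y hy
      rw [fderiv_green_apply k hy]
      simp [basisVec, PiLp.inner_apply]
    rw [heq.fderiv_eq]
    have h1 := (hasDerivAt_gradCoeff k hr).hasFDerivAt.comp v (hasFDerivAt_norm hv)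
    have h2 : HasFDerivAt (fun y : Space => ((y i : ℝ) : ℂ))
        (Complex.ofRealCLM.comp (EuclideanSpace.proj i : Space →L[ℝ] ℝ)) v :=
      (Complex.ofRealCLM.comp (EuclideanSpace.proj i : Space →L[ℝ] ℝ)).hasFDerivAt
    have h3 := h1.fun_mul h2
    simp only [Function.comp_def] at h3
    rw [h3.fderiv]
    simp [basisVec, PiLp.inner_apply, c']
    field_simp
    ring
  have hsum : ∑ i, ((v i : ℂ)) ^ 2 = (‖v‖ : ℂ) ^ 2 := by
    rw [← Complex.ofReal_pow, EuclideanSpace.norm_sq_eq]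
    simp
  simp_rw [key]
  rw [Finset.sum_add_distrib, ← Finset.mul_sum, hsum]
  simp only [Finset.sum_const, Finset.card_univ, Fintype.card_fin, nsmul_eq_mul, green, gradCoeff,
    c', mul_pow, Complex.I_sq]
  field_simp
  push_cast
  ring

theorem laplacian_comp_sub (f : Space → ℂ) (a x : Space) :
    Laplacian.laplacian (fun y => f (y - a)) x = Laplacian.laplacian f (x - a) := by
  rw [InnerProductSpace.laplacian_eq_iteratedFDeriv_stdOrthonormalBasis,
    InnerProductSpace.laplacian_eq_iteratedFDeriv_stdOrthonormalBasis]
  simp only [iteratedFDeriv_comp_sub]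

theorem laplacian_green_sub (k : ℝ) {R x : Space} (hx : x ≠ R) :
    Laplacian.laplacian (fun y => green k (y - R)) x = -(k : ℂ) ^ 2 * green k (x - R) := by
  rw [laplacian_comp_sub, laplacian_green k (sub_ne_zero.2 hx)]

/-! ### The reflected wave as a point source at the image of the transmitter. -/

theorem norm_mirror_sub (x T : Space) : ‖mirror x - T‖ = ‖x - mirror T‖ := by
  rw [EuclideanSpace.norm_eq, EuclideanSpace.norm_eq]
  simp only [Fin.sum_univ_three, mirror, PiLp.sub_apply, Real.norm_eq_abs, sq_abs]
  simp
  ring_nf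

/-- The mirror map is an isometric involution and `green` depends only on the norm, so the
reflection can be moved from the point to the source. -/
theorem reflectedWave_eq (k : ℝ) (T : Space) (Γ A : ℂ) :
    reflectedWave k T Γ A = (Γ * A) • fun x => green k (x - mirror T) := by
  ext x
  simp only [reflectedWave, incidentWave, green, norm_mirror_sub, Pi.smul_apply, smul_eq_mul]
  ring

theorem isHelmholtz_reflectedWave (k : ℝ) {T : Space} (hT : 0 < T 2) (Γ A : ℂ) :
    IsHelmholtz k (reflectedWave k T Γ A) := by
  intro x hx
  have hne : x ≠ mirror T := by
    rintro rfl
    simp [mirror] at hx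
    linarith
  have h := contDiffAt_green_sub k (n := 2) hne
  rw [reflectedWave_eq]
  refine ⟨contDiffAt_const.smul h, ?_⟩
  rw [InnerProductSpace.laplacian_smul _ h, laplacian_green_sub k hne]
  simp only [Pi.smul_apply, smul_eq_mul]
  ring

theorem norm_green (k : ℝ) (v : Space) : ‖green k v‖ = 1 / ‖v‖ := by
  simp [green, Complex.norm_exp]

/-- Sommerfeld's condition, with a rate, for a point source. -/
theorem exists_sommerfeld_bound (k : ℝ) (y : Space) :
    ∃ C : ℝ, 0 ≤ C ∧ ∀ x : Space, 2 * ‖y‖ + 1 ≤ ‖x‖ →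
      ‖green k (x - y)‖ ≤ 2 / ‖x‖ ∧
      ‖fderiv ℝ (fun z => green k (z - y)) x (‖x‖⁻¹ • x) + Complex.I * k * green k (x - y)‖ ≤
        C / ‖x‖ ^ 2 := by
  -- The `4` comes from bounding `1/|x - y|` twice by `2/|x|`; the other factor bounds the bracket
  -- in `hid`.
  refine ⟨4 * (2 * |k| * ‖y‖ + 1), by positivity, fun x hx => ?_⟩
  have hxpos : 0 < ‖x‖ := by linarith [norm_nonneg y]
  set s := ‖x - y‖ with hs
  have hs1 : ‖x‖ / 2 ≤ s := by
    have := norm_sub_norm_le x y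
    linarith
  have hspos : 0 < s := by linarith
  have hs2 : s ≤ ‖x‖ + ‖y‖ := norm_sub_le x y
  have hs3 : ‖x‖ - ‖y‖ ≤ s := norm_sub_norm_le x y
  have hinv : 1 / s ≤ 2 / ‖x‖ := by
    rw [div_le_div_iff₀ hspos hxpos]
    linarith
  have hg : ‖green k (x - y)‖ = 1 / s := norm_green k _
  refine ⟨hg ▸ hinv, ?_⟩
  have hne : x - y ≠ 0 := norm_pos_iff.1 hspos
  set q : ℝ := ⟪x - y, ‖x‖⁻¹ • x⟫ with hq
  have hq1 : q = ‖x‖ - ‖x‖⁻¹ * ⟪y, x⟫ := by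
    rw [hq, inner_smul_right, inner_sub_left, real_inner_self_eq_norm_sq]
    field_simp
  have hq2 : |‖x‖⁻¹ * ⟪y, x⟫| ≤ ‖y‖ := by
    rw [abs_mul, abs_of_pos (inv_pos.2 hxpos)]
    calc ‖x‖⁻¹ * |⟪y, x⟫| ≤ ‖x‖⁻¹ * (‖y‖ * ‖x‖) := by gcongr; exact abs_real_inner_le_norm y x
      _ = ‖y‖ := by field_simp
  have hq3 : |s - q| ≤ 2 * ‖y‖ := by
    rw [hq1]
    rw [abs_le] at hq2 ⊢
    constructor <;> linarith [hq2.1, hq2.2]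
  have hq4 : |q| ≤ s := by
    refine (abs_real_inner_le_norm _ _).trans_eq ?_
    rw [norm_smul, norm_inv, norm_norm, inv_mul_cancel₀ hxpos.ne', mul_one]
  -- The phase terms nearly cancel: `s - q` stays bounded as `x` goes to infinity, which gains the
  -- extra power of `1/|x|`.
  have hid : fderiv ℝ (fun z => green k (z - y)) x (‖x‖⁻¹ • x) + Complex.I * k * green k (x - y)
      = green k (x - y) * (1 / s : ℝ) * (Complex.I * k * (s - q : ℝ) - (q / s : ℝ)) := by
    have hsne : (s : ℂ) ≠ 0 := by exact_mod_cast hspos.ne'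
    rw [fderiv_green_sub, fderiv_green_apply k hne, green, gradCoeff, ← hs, ← hq]
    push_cast
    field_simp
    ring
  rw [hid, norm_mul, norm_mul, hg, Complex.norm_real, Real.norm_of_nonneg (by positivity)]
  have hb : ‖Complex.I * k * (s - q : ℝ) - (q / s : ℝ)‖ ≤ 2 * |k| * ‖y‖ + 1 := by
    refine (norm_sub_le _ _).trans (add_le_add ?_ ?_)
    · rw [norm_mul, norm_mul, Complex.norm_I, one_mul, Complex.norm_real, Complex.norm_real,
        Real.norm_eq_abs, Real.norm_eq_abs]
      nlinarith [abs_nonneg k]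
    · rw [Complex.norm_real, Real.norm_eq_abs, abs_div, abs_of_pos hspos]
      exact div_le_one_of_le₀ hq4 hspos.le
  calc 1 / s * (1 / s) * ‖Complex.I * k * (s - q : ℝ) - (q / s : ℝ)‖
      ≤ 2 / ‖x‖ * (2 / ‖x‖) * (2 * |k| * ‖y‖ + 1) := by gcongr
    _ = 4 * (2 * |k| * ‖y‖ + 1) / ‖x‖ ^ 2 := by field_simp; ring

theorem isRadiating_reflectedWave (k : ℝ) {T : Space} (hT : 0 < T 2) (Γ A : ℂ) :
    IsRadiating k (reflectedWave k T Γ A) := by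
  have hd : ∀ x : Space, 0 < x 2 → DifferentiableAt ℝ (fun x => green k (x - mirror T)) x := by
    intro x hx
    refine (contDiffAt_green_sub k (n := 1) ?_).differentiableAt one_ne_zero
    rintro rfl
    simp [mirror] at hx
    linarith
  obtain ⟨C, hC0, hC⟩ := exists_sommerfeld_bound k (mirror T)
  have hpos : ∀ x : Space, 2 * ‖mirror T‖ + 1 ≤ ‖x‖ → 0 < ‖x‖ := fun x hx => by
    linarith [norm_nonneg (mirror T)]
  rw [reflectedWave_eq]
  refine ⟨fun x hx => (hd x hx).const_smul _, ⟨‖Γ * A‖ * 2, 2 * ‖mirror T‖ + 1, fun x _ hr => ?_⟩,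
    fun ε hε => ⟨max (2 * ‖mirror T‖ + 1) (‖Γ * A‖ * C / ε), fun x hx hr => ?_⟩⟩
  · rw [Pi.smul_apply, norm_smul, mul_div_assoc]
    exact mul_le_mul_of_nonneg_left (hC x hr).1 (norm_nonneg _)
  · have hr1 := (le_max_left _ _).trans hr
    have hr2 := (le_max_right _ _).trans hr
    have h0 := hpos x hr1
    rw [fderiv_const_smul (hd x hx)]
    have : ((Γ * A) • fderiv ℝ (fun x => green k (x - mirror T)) x) (‖x‖⁻¹ • x) +
        Complex.I * k * ((Γ * A) • fun x => green k (x - mirror T)) x =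
        (Γ * A) * (fderiv ℝ (fun x => green k (x - mirror T)) x (‖x‖⁻¹ • x) +
          Complex.I * k * green k (x - mirror T)) := by
      simp only [smul_apply, Pi.smul_apply, smul_eq_mul]
      ring
    rw [this, norm_mul]
    rw [div_le_iff₀ hε] at hr2
    calc _ ≤ ‖x‖ * (‖Γ * A‖ * (C / ‖x‖ ^ 2)) := by gcongr; exact (hC x hr1).2
      _ = ‖Γ * A‖ * C / ‖x‖ := by field_simp
      _ ≤ ε := by rw [div_le_iff₀ h0]; linarith

/-! ### Smooth radial cut-offs and approximate identities. -/

section Profile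

/-- A smooth profile that equals `1` up to `ρ ^ 2` and `0` from `ρ ^ 2 + δ` on. -/
def outerProfile (ρ δ s : ℝ) : ℝ := Real.smoothTransition (1 + (ρ ^ 2 - s) / δ)

/-- A smooth profile that equals `0` up to `δ` and `1` from `2 δ` on. -/
def innerProfile (δ s : ℝ) : ℝ := Real.smoothTransition (s / δ - 1)

variable {ρ δ s : ℝ}

theorem contDiff_outerProfile (ρ δ : ℝ) : ContDiff ℝ 1 (outerProfile ρ δ) := by
  have : ContDiff ℝ 1 fun s : ℝ => 1 + (ρ ^ 2 - s) / δ := by fun_prop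
  exact Real.smoothTransition.contDiff.comp this

theorem contDiff_innerProfile (δ : ℝ) : ContDiff ℝ 1 (innerProfile δ) := by
  have : ContDiff ℝ 1 fun s : ℝ => s / δ - 1 := by fun_prop
  exact Real.smoothTransition.contDiff.comp this

theorem outerProfile_eq_one (hδ : 0 < δ) (h : s ≤ ρ ^ 2) : outerProfile ρ δ s = 1 :=
  Real.smoothTransition.one_of_one_le
    (le_add_of_nonneg_right (div_nonneg (sub_nonneg.2 h) hδ.le))

theorem outerProfile_eq_zero (hδ : 0 < δ) (h : ρ ^ 2 + δ ≤ s) : outerProfile ρ δ s = 0 := by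
  refine Real.smoothTransition.zero_of_nonpos ?_
  have : (ρ ^ 2 - s) / δ ≤ -1 := by rw [div_le_iff₀ hδ]; linarith
  linarith

theorem innerProfile_eq_zero (hδ : 0 < δ) (h : s ≤ δ) : innerProfile δ s = 0 := by
  refine Real.smoothTransition.zero_of_nonpos ?_
  have : s / δ ≤ 1 := by rwa [div_le_one hδ]
  linarith

theorem innerProfile_eq_one (hδ : 0 < δ) (h : 2 * δ ≤ s) : innerProfile δ s = 1 := by
  refine Real.smoothTransition.one_of_one_le ?_
  have : 2 ≤ s / δ := by rwa [le_div_iff₀ hδ]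
  linarith

theorem deriv_outerProfile_nonpos (hδ : 0 < δ) : deriv (outerProfile ρ δ) s ≤ 0 := by
  have : Antitone (outerProfile ρ δ) := fun a b hab =>
    Real.smoothTransition.monotone (by gcongr)
  exact this.deriv_nonpos

theorem deriv_innerProfile_nonneg (hδ : 0 < δ) : 0 ≤ deriv (innerProfile δ) s := by
  have : Monotone (innerProfile δ) := fun a b hab =>
    Real.smoothTransition.monotone (by gcongr)
  exact this.deriv_nonneg

theorem deriv_eq_zero_of_eqOn_isOpen {h : ℝ → ℝ} {c : ℝ} {u : Set ℝ} (hu : IsOpen u)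
    (hc : ∀ t ∈ u, h t = c) (hs : s ∈ u) : deriv h s = 0 := by
  have : h =ᶠ[𝓝 s] fun _ => c := by
    filter_upwards [hu.mem_nhds hs] with t ht using hc t ht
  rw [this.deriv_eq, deriv_const]

theorem mem_Icc_of_deriv_outerProfile_ne_zero (hδ : 0 < δ) (h : deriv (outerProfile ρ δ) s ≠ 0) :
    s ∈ Icc (ρ ^ 2) (ρ ^ 2 + δ) := by
  constructor <;> by_contra! hs <;> refine h ?_
  · exact deriv_eq_zero_of_eqOn_isOpen isOpen_Iio
      (fun t ht => outerProfile_eq_one hδ (mem_Iio.1 ht).le) hs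
  · exact deriv_eq_zero_of_eqOn_isOpen isOpen_Ioi
      (fun t ht => outerProfile_eq_zero hδ (mem_Ioi.1 ht).le) hs

theorem mem_Icc_of_deriv_innerProfile_ne_zero (hδ : 0 < δ) (h : deriv (innerProfile δ) s ≠ 0) :
    s ∈ Icc δ (2 * δ) := by
  constructor <;> by_contra! hs <;> refine h ?_
  · exact deriv_eq_zero_of_eqOn_isOpen isOpen_Iio
      (fun t ht => innerProfile_eq_zero hδ (mem_Iio.1 ht).le) hs
  · exact deriv_eq_zero_of_eqOn_isOpen isOpen_Ioi
      (fun t ht => innerProfile_eq_one hδ (mem_Ioi.1 ht).le) hs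

/-- The derivative of `r ↦ h (r ^ 2)` integrates to the total increment of `h`. -/
theorem integrableOn_and_integral_radial_weight {h : ℝ → ℝ} (hh : ContDiff ℝ 1 h) {β c : ℝ}
    (hc : ∀ s, β ≤ s → h s = c) :
    IntegrableOn (fun r => 2 * r * deriv h (r ^ 2)) (Ioi 0) ∧
      ∫ r in Ioi (0 : ℝ), 2 * r * deriv h (r ^ 2) = c - h 0 := by
  have hcont : Continuous fun r : ℝ => 2 * r * deriv h (r ^ 2) :=
    (continuous_const.mul continuous_id).mul
      ((hh.continuous_deriv le_rfl).comp (continuous_pow 2))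
  have hd : ∀ r : ℝ, HasDerivAt (fun r => h (r ^ 2)) (2 * r * deriv h (r ^ 2)) r := by
    intro r
    have h1 := (hh.differentiable one_ne_zero (r ^ 2)).hasDerivAt.comp r (hasDerivAt_pow 2 r)
    refine h1.congr_deriv ?_
    simp
    ring
  -- Beyond `|β| + 1` the weight vanishes, so integrability reduces to a compact interval.
  have hbig : ∀ r : ℝ, |β| + 1 < r → β < r ^ 2 := fun r hr => by
    nlinarith [le_abs_self β, abs_nonneg β]
  have hint : IntegrableOn (fun r => 2 * r * deriv h (r ^ 2)) (Ioi 0) := by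
    have h1 : IntegrableOn (fun r => 2 * r * deriv h (r ^ 2)) (Icc 0 (|β| + 1)) :=
      hcont.continuousOn.integrableOn_compact isCompact_Icc
    refine h1.of_forall_sdiff_eq_zero measurableSet_Ioi fun r hr => ?_
    have hr' : |β| + 1 < r := by
      by_contra! hle
      exact hr.2 ⟨hr.1.out.le, hle⟩
    rw [deriv_eq_zero_of_eqOn_isOpen isOpen_Ioi (fun t ht => hc t (mem_Ioi.1 ht).le)
      (hbig r hr'), mul_zero]
  refine ⟨hint, ?_⟩
  have hlim : Tendsto (fun r : ℝ => h (r ^ 2)) atTop (𝓝 c) := by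
    refine tendsto_const_nhds.congr' ?_
    filter_upwards [eventually_gt_atTop (|β| + 1)] with r hr
    exact (hc _ (hbig r hr).le).symm
  rw [integral_Ioi_of_hasDerivAt_of_tendsto (hd 0).continuousAt.continuousWithinAt
    (fun r _ => hd r) hint hlim]
  simp

end Profile

/-- An average against a probability density lies within `ε` of `L` as soon as `K` does so on the
support of the density. Here `K` is a flux as a function of the radius, and this lemma turns shell
averages into fluxes through a single surface. -/
theorem tendsto_integral_of_concentrating_weight {ι : Type*} {l : Filter ι} {w : ι → ℝ → ℝ}
    {K : ℝ → ℂ} {L : ℂ} {s : Set ℝ} (hs : MeasurableSet s)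
    (hw : ∀ᶠ i in l, ∀ r ∈ s, 0 ≤ w i r) (hwi : ∀ᶠ i in l, IntegrableOn (w i) s)
    (hw1 : ∀ᶠ i in l, ∫ r in s, w i r = 1)
    (hK : ∀ᶠ i in l, IntegrableOn (fun r => (w i r : ℂ) * K r) s)
    (hconc : ∀ ε > 0, ∀ᶠ i in l, ∀ r ∈ s, w i r ≠ 0 → ‖K r - L‖ ≤ ε) :
    Tendsto (fun i => ∫ r in s, (w i r : ℂ) * K r) l (𝓝 L) := by
  refine Metric.tendsto_nhds.2 fun ε hε => ?_
  filter_upwards [hw, hwi, hw1, hK, hconc (ε / 2) (half_pos hε)] with i h0 hi h1 hKi hc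
  have hLi : IntegrableOn (fun r => (w i r : ℂ) * L) s := hi.ofReal.mul_const L
  have hL : ∫ r in s, (w i r : ℂ) * L = L := by
    have : ∫ r in s, (w i r : ℂ) * L = (∫ r in s, (w i r : ℂ)) * L := integral_mul_const _ _
    rw [this, integral_complex_ofReal, h1, Complex.ofReal_one, one_mul]
  have hsub : (∫ r in s, (w i r : ℂ) * K r) - L = ∫ r in s, (w i r : ℂ) * (K r - L) := by
    conv_lhs => rw [← hL]
    rw [← integral_sub hKi hLi]
    simp only [mul_sub]
  rw [dist_eq_norm, hsub]
  calc ‖∫ r in s, (w i r : ℂ) * (K r - L)‖ ≤ ∫ r in s, w i r * (ε / 2) := by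
        refine norm_integral_le_of_norm_le (hi.mul_const _) ?_
        filter_upwards [ae_restrict_mem hs] with r hr
        rw [norm_mul, Complex.norm_real, Real.norm_of_nonneg (h0 r hr)]
        rcases eq_or_ne (w i r) 0 with hz | hz
        · simp [hz]
        · exact mul_le_mul_of_nonneg_left (hc r hr hz) (h0 r hr)
    _ = ε / 2 := by rw [integral_mul_const, h1, one_mul]
    _ < ε := half_lt_self hε

/-! ### The divergence-free field behind the Helmholtz–Kirchhoff integrand. -/

section Density

variable {k : ℝ} {R : Space} {V : Space → ℂ}

/-- Exhibits the density as one linear map applied to `ν`, from which additivity and homogeneity in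
`ν` follow. -/
theorem hkDensity_eq (k : ℝ) (R : Space) (V : Space → ℂ) (x ν : Space) :
    hkDensity k R V x ν =
      (green k (x - R) • fderiv ℝ V x - V x • fderiv ℝ (fun y => green k (y - R)) x) ν := by
  simp [hkDensity, mul_comm]

theorem hkDensity_smul (k : ℝ) (R : Space) (V : Space → ℂ) (x ν : Space) (c : ℝ) :
    hkDensity k R V x (c • ν) = c * hkDensity k R V x ν := by
  rw [hkDensity_eq, map_smul, hkDensity_eq, Complex.real_smul]

theorem hkDensity_add (k : ℝ) (R : Space) (V : Space → ℂ) (x ν μ : Space) :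
    hkDensity k R V x (ν + μ) = hkDensity k R V x ν + hkDensity k R V x μ := by
  simp only [hkDensity_eq, map_add]

theorem hkDensity_neg (k : ℝ) (R : Space) (V : Space → ℂ) (x ν : Space) :
    hkDensity k R V x (-ν) = -hkDensity k R V x ν := by
  simp only [hkDensity_eq, map_neg]

theorem eq_sum_basisVec (v : Space) : v = ∑ i, v i • basisVec i := by
  ext j
  fin_cases j <;> simp [basisVec, Fin.sum_univ_three]

theorem hkDensity_eq_sum (k : ℝ) (R : Space) (V : Space → ℂ) (x ν : Space) :
    hkDensity k R V x ν = ∑ i, (ν i : ℂ) * hkDensity k R V x (basisVec i) := by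
  conv_lhs => rw [eq_sum_basisVec ν]
  simp only [hkDensity_eq, map_sum, map_smul, Complex.real_smul]

theorem contDiffAt_hkDensity (hV : ContDiff ℝ 2 V) {x : Space} (hx : x ≠ R) (ν : Space) :
    ContDiffAt ℝ 1 (fun y => hkDensity k R V y ν) x := by
  have h1 : ContDiffAt ℝ 1 (fun y => fderiv ℝ V y ν) x :=
    (hV.contDiffAt.fderiv_right (m := 1) (by norm_num)).clm_apply contDiffAt_const
  have h2 : ContDiffAt ℝ 1 (fun y => fderiv ℝ (fun z => green k (z - R)) y ν) x :=
    ((contDiffAt_green_sub k (n := 2) hx).fderiv_right (m := 1) (by norm_num)).clm_apply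
      contDiffAt_const
  exact (h1.mul (contDiffAt_green_sub k hx)).sub ((hV.contDiffAt.of_le (by norm_num)).mul h2)

theorem continuousAt_hkDensity (hV : ContDiff ℝ 2 V) {X : Type*} [TopologicalSpace X]
    {f ν : X → Space} {p : X} (hf : ContinuousAt f p) (hν : ContinuousAt ν p) (hp : f p ≠ R) :
    ContinuousAt (fun q => hkDensity k R V (f q) (ν q)) p := by
  simp only [hkDensity_eq_sum k R V (f _) (ν _)]
  refine tendsto_finsetSum _ fun i _ => ?_
  have h1 : ContinuousAt (fun q => ((ν q i : ℝ) : ℂ)) p :=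
    Complex.continuous_ofReal.continuousAt.comp
      ((EuclideanSpace.proj i : Space →L[ℝ] ℝ).continuous.continuousAt.comp hν)
  exact h1.mul ((contDiffAt_hkDensity hV hp (basisVec i)).continuousAt.comp hf)

/-- In `div (g ∇V - V ∇g) = g ΔV - V Δg` the products of gradients cancel, and both Laplacians are
`-k²` times their function. -/
theorem sum_fderiv_hkDensity (hV : ContDiff ℝ 2 V) {x : Space} (hx : x ≠ R)
    (hΔ : Laplacian.laplacian V x + (k : ℂ) ^ 2 * V x = 0) :
    ∑ i, fderiv ℝ (fun y => hkDensity k R V y (basisVec i)) x (basisVec i) = 0 := by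
  have hgc := contDiffAt_green_sub k (n := 2) hx
  have hVd : DifferentiableAt ℝ V x := hV.contDiffAt.differentiableAt two_ne_zero
  have hgd := hgc.differentiableAt two_ne_zero
  have key : ∀ i, fderiv ℝ (fun y => hkDensity k R V y (basisVec i)) x (basisVec i) =
      fderiv ℝ (fun y => fderiv ℝ V y (basisVec i)) x (basisVec i) * green k (x - R) -
      V x * fderiv ℝ (fun y => fderiv ℝ (fun z => green k (z - R)) y (basisVec i)) x
        (basisVec i) := by
    intro i
    have h1 : DifferentiableAt ℝ (fun y => fderiv ℝ V y (basisVec i)) x :=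
      ((hV.contDiffAt.fderiv_right (m := 1) (by norm_num)).clm_apply
        contDiffAt_const).differentiableAt one_ne_zero
    have h2 : DifferentiableAt ℝ (fun y => fderiv ℝ (fun z => green k (z - R)) y (basisVec i)) x :=
      ((hgc.fderiv_right (m := 1) (by norm_num)).clm_apply
        contDiffAt_const).differentiableAt one_ne_zero
    have h3 := (h1.hasFDerivAt.fun_mul hgd.hasFDerivAt).fun_sub
      (hVd.hasFDerivAt.fun_mul h2.hasFDerivAt)
    have h4 : fderiv ℝ (fun y => hkDensity k R V y (basisVec i)) x = _ := h3.fderiv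
    rw [h4]
    simp only [sub_apply, add_apply, smul_apply, smul_eq_mul]
    ring
  simp_rw [key]
  rw [Finset.sum_sub_distrib, ← Finset.sum_mul, ← Finset.mul_sum,
    ← laplacian_eq_sum_fderiv hV.contDiffAt, ← laplacian_eq_sum_fderiv hgc,
    laplacian_green_sub k hx, eq_neg_of_add_eq_zero_left hΔ]
  ring

/-- Green's identity on the half-space for the Helmholtz–Kirchhoff field, tested against a cut-off
function `χ` with gradient `G` that vanishes near the observation point. -/
theorem setIntegral_upperSpace_hkDensity_gradient (hV : ContDiff ℝ 2 V) {χ : Space → ℝ}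
    {G : Space → Space} (hχ : ContDiff ℝ 1 χ) (hχc : HasCompactSupport χ)
    (hχR : χ =ᶠ[𝓝 R] fun _ => 0) (hG : ∀ x, HasFDerivAt χ (innerSL ℝ (G x)) x)
    (hΔ : ∀ x ∈ upperSpace, χ x ≠ 0 → Laplacian.laplacian V x + (k : ℂ) ^ 2 * V x = 0) :
    ∫ x in upperSpace, hkDensity k R V x (G x) =
      -∫ p : ℝ × ℝ, χ (planePoint p) * hkDensity k R V (planePoint p) (basisVec 2) := by
  set f : Fin 3 → Space → ℂ := fun i x => χ x * hkDensity k R V x (basisVec i) with hfdef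
  have hχ' : ContDiff ℝ 1 fun x => (χ x : ℂ) := Complex.ofRealCLM.contDiff.comp hχ
  have hf0 : ∀ i, f i =ᶠ[𝓝 R] fun _ => 0 := fun i => by
    filter_upwards [hχR] with x hx
    simp [f, hx]
  have hf : ∀ i, ContDiff ℝ 1 (f i) := fun i => contDiff_iff_contDiffAt.2 fun x => by
    rcases eq_or_ne x R with rfl | hx
    · exact contDiffAt_const.congr_of_eventuallyEq (hf0 i)
    · exact hχ'.contDiffAt.mul (contDiffAt_hkDensity hV hx _)
  have hfc : ∀ i, HasCompactSupport (f i) := fun i => by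
    refine hχc.mono fun x hx => ?_
    simp only [Function.mem_support, f] at hx ⊢
    exact fun h => hx (by simp [h])
  rw [← setIntegral_upperSpace_divergence hf hfc]
  refine setIntegral_congr_fun isOpen_upperSpace.measurableSet fun x hx => ?_
  show hkDensity k R V x (G x) = ∑ i, fderiv ℝ (f i) x (basisVec i)
  -- At the singular point both sides vanish, since `χ` is zero near it; elsewhere this is the
  -- product rule for `div (χ F)`.
  rcases eq_or_ne x R with rfl | hxR
  · have hG0 : G x = 0 := by
      have h1 := (hG x).unique ((hasFDerivAt_const (0 : ℝ) x).congr_of_eventuallyEq hχR)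
      have h2 := congrArg (fun L : Space →L[ℝ] ℝ => L (G x)) h1
      simpa using h2
    simp only [(hf0 _).fderiv_eq, hG0]
    simp [hkDensity]
  · have hd : ∀ i, fderiv ℝ (f i) x (basisVec i) = (G x i : ℂ) * hkDensity k R V x (basisVec i) +
        χ x * fderiv ℝ (fun y => hkDensity k R V y (basisVec i)) x (basisVec i) := by
      intro i
      have h1 : HasFDerivAt (fun x => (χ x : ℂ)) (Complex.ofRealCLM.comp (innerSL ℝ (G x))) x :=
        Complex.ofRealCLM.hasFDerivAt.comp x (hG x)
      have h2 := ((contDiffAt_hkDensity (k := k) hV hxR (basisVec i)).differentiableAt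
        one_ne_zero).hasFDerivAt
      have h3 : fderiv ℝ (f i) x = _ := (h1.fun_mul h2).fderiv
      rw [h3]
      simp [basisVec, PiLp.inner_apply]
      ring
    simp_rw [hd]
    rw [Finset.sum_add_distrib, ← hkDensity_eq_sum, ← Finset.mul_sum]
    by_cases hx0 : χ x = 0
    · simp [hx0]
    · rw [sum_fderiv_hkDensity hV hxR (hΔ x hx hx0), mul_zero, add_zero]

end Density

/-! ### Green's identity with cut-offs, written as radial averages of fluxes. -/

section Cutoff

variable {k ρ δ : ℝ} {R : Space} {V : Space → ℂ}

theorem hasFDerivAt_profile_norm_sq {h : ℝ → ℝ} (hh : ContDiff ℝ 1 h) (a x : Space) :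
    HasFDerivAt (fun y : Space => h (‖y - a‖ ^ 2))
      (innerSL ℝ ((2 * deriv h (‖x - a‖ ^ 2)) • (x - a))) x := by
  have h1 : HasFDerivAt (fun y : Space => ‖y - a‖ ^ 2) (2 • innerSL ℝ (x - a)) x := by
    simpa using (hasFDerivAt_id x).sub_const a |>.norm_sq
  have h2 := (hh.differentiable one_ne_zero (‖x - a‖ ^ 2)).hasDerivAt.comp_hasFDerivAt x h1
  refine h2.congr_fderiv ?_
  ext w
  simp
  ring

theorem contDiff_profile_norm_sq {h : ℝ → ℝ} (hh : ContDiff ℝ 1 h) (a : Space) :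
    ContDiff ℝ 1 (fun y : Space => h (‖y - a‖ ^ 2)) :=
  hh.comp ((contDiff_id.sub contDiff_const).norm_sq ℝ)

/-- The weight vanishes near `R`, which removes the only singularity and leaves a continuous
function of compact support. -/
theorem integrable_hkDensity_of_hasCompactSupport (hV : ContDiff ℝ 2 V) {w : Space → ℝ}
    (hw : Continuous w) (hwc : HasCompactSupport w) (hwR : w =ᶠ[𝓝 R] fun _ => 0) (a : Space) :
    Integrable fun x => hkDensity k R V x (w x • (x - a)) := by
  refine Continuous.integrable_of_hasCompactSupport ?_ ?_
  · refine continuous_iff_continuousAt.2 fun x => ?_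
    rcases eq_or_ne x R with rfl | hx
    · refine (continuousAt_const (y := (0 : ℂ))).congr ?_
      filter_upwards [hwR] with y hy
      simp [hy, hkDensity]
    · exact continuousAt_hkDensity hV continuousAt_id
        (hw.continuousAt.smul (continuousAt_id.sub continuousAt_const)) hx
  · refine hwc.mono fun x hx => ?_
    simp only [Function.mem_support] at hx ⊢
    exact fun h => hx (by simp [h, hkDensity])

/-- The flux through the sphere of radius `r` about the observation point. -/
def sphereFlux (k : ℝ) (R : Space) (V : Space → ℂ) (r : ℝ) : ℂ :=
  (r : ℂ) ^ 2 * ∫ ω : sphere (0 : Space) 1, hkDensity k R V (r • (ω : Space) + R) (ω : Space)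
    ∂((volume : Measure Space).toSphere)

theorem capFlux_eq (k : ℝ) (R : Space) (V : Space → ℂ) (r : ℝ) :
    capFlux k R V r = (r : ℂ) ^ 2 * ∫ ω in upperSphere,
      hkDensity k R V (r • (ω : Space)) (ω : Space) ∂((volume : Measure Space).toSphere) := rfl

/-- The gradient of `h (|x|²)` is radial, of signed length `d/dr h(r²)`; this factor becomes the
weight in the radial averages. -/
theorem hkDensity_radial (k : ℝ) (R : Space) (V : Space → ℂ) {r : ℝ} (hr : 0 < r) (h : ℝ → ℝ)
    (a : Space) (ω : sphere (0 : Space) 1) :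
    hkDensity k R V (r • (ω : Space) + a) ((2 * deriv h (‖r • (ω : Space)‖ ^ 2)) •
      (r • (ω : Space))) =
      ((2 * r * deriv h (r ^ 2) : ℝ) : ℂ) * hkDensity k R V (r • (ω : Space) + a) ω := by
  have hn : ‖r • (ω : Space)‖ = r := by simp [norm_smul, abs_of_pos hr]
  rw [hn, smul_smul, hkDensity_smul]
  push_cast
  ring

theorem integral_cap_weight (hV : ContDiff ℝ 2 V) {h : ℝ → ℝ} (hh : ContDiff ℝ 1 h)
    (hc : HasCompactSupport fun x : Space => 2 * deriv h (‖x‖ ^ 2))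
    (hR : (fun x : Space => 2 * deriv h (‖x‖ ^ 2)) =ᶠ[𝓝 R] fun _ => 0) :
    IntegrableOn (fun r => ((2 * r * deriv h (r ^ 2) : ℝ) : ℂ) * capFlux k R V r) (Ioi 0) ∧
    ∫ x in upperSpace, hkDensity k R V x ((2 * deriv h (‖x‖ ^ 2)) • x) =
      ∫ r in Ioi (0 : ℝ), ((2 * r * deriv h (r ^ 2) : ℝ) : ℂ) * capFlux k R V r := by
  have hcont : Continuous fun x : Space => 2 * deriv h (‖x‖ ^ 2) :=
    continuous_const.mul ((hh.continuous_deriv le_rfl).comp (continuous_norm.pow 2))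
  have hint : Integrable fun x => hkDensity k R V x ((2 * deriv h (‖x‖ ^ 2)) • x) := by
    simpa using integrable_hkDensity_of_hasCompactSupport (k := k) hV hcont hc hR 0
  have h1 := integrableOn_and_integral_polar_upperSpace hint.integrableOn
  have key : ∀ r ∈ Ioi (0 : ℝ), r ^ 2 • ∫ ω in upperSphere, hkDensity k R V (r • (ω : Space))
      ((2 * deriv h (‖r • (ω : Space)‖ ^ 2)) • (r • (ω : Space)))
      ∂(volume : Measure Space).toSphere =
      ((2 * r * deriv h (r ^ 2) : ℝ) : ℂ) * capFlux k R V r := by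
    intro r hr
    have h2 := fun ω => hkDensity_radial k R V hr.out h 0 ω
    simp only [add_zero] at h2
    simp_rw [h2]
    rw [integral_const_mul, capFlux_eq, Complex.real_smul]
    push_cast
    ring
  rwa [setIntegral_congr_fun measurableSet_Ioi key,
    integrableOn_congr_fun key measurableSet_Ioi] at h1

theorem integral_sphere_weight (hV : ContDiff ℝ 2 V) {h : ℝ → ℝ} (hh : ContDiff ℝ 1 h)
    (hc : HasCompactSupport fun x : Space => 2 * deriv h (‖x - R‖ ^ 2))
    (hR : (fun x : Space => 2 * deriv h (‖x - R‖ ^ 2)) =ᶠ[𝓝 R] fun _ => 0) :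
    IntegrableOn (fun r => ((2 * r * deriv h (r ^ 2) : ℝ) : ℂ) * sphereFlux k R V r) (Ioi 0) ∧
    ∫ x, hkDensity k R V x ((2 * deriv h (‖x - R‖ ^ 2)) • (x - R)) =
      ∫ r in Ioi (0 : ℝ), ((2 * r * deriv h (r ^ 2) : ℝ) : ℂ) * sphereFlux k R V r := by
  have hcont : Continuous fun x : Space => 2 * deriv h (‖x - R‖ ^ 2) :=
    continuous_const.mul ((hh.continuous_deriv le_rfl).comp
      ((continuous_id.sub continuous_const).norm.pow 2))
  have hint := integrable_hkDensity_of_hasCompactSupport (k := k) hV hcont hc hR R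
  -- Translation by `R` allows polar coordinates about the observation point.
  have h1 := integrableOn_and_integral_polar volume (hint.comp_add_right R)
  rw [integral_add_right_eq_self
    (fun x => hkDensity k R V x ((2 * deriv h (‖x - R‖ ^ 2)) • (x - R)))] at h1
  simp only [finrank_euclideanSpace, Fintype.card_fin, Nat.add_one_sub_one,
    add_sub_cancel_right] at h1
  have key : ∀ r ∈ Ioi (0 : ℝ), r ^ 2 • ∫ ω : sphere (0 : Space) 1,
      hkDensity k R V (r • (ω : Space) + R)
      ((2 * deriv h (‖r • (ω : Space)‖ ^ 2)) • (r • (ω : Space)))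
      ∂(volume : Measure Space).toSphere =
      ((2 * r * deriv h (r ^ 2) : ℝ) : ℂ) * sphereFlux k R V r := by
    intro r hr
    simp_rw [fun ω => hkDensity_radial k R V hr.out h R ω]
    rw [integral_const_mul, sphereFlux, Complex.real_smul]
    push_cast
    ring
  rwa [setIntegral_congr_fun measurableSet_Ioi key,
    integrableOn_congr_fun key measurableSet_Ioi] at h1

/-- The thickness `δ` is small enough for the cut-off to separate the observation point from the
boundary of the half-ball of radius `ρ`. -/
structure IsThin (R : Space) (ρ δ : ℝ) : Prop where
  pos : 0 < δ
  le_one : δ ≤ 1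
  lt_height : 2 * δ < R 2 ^ 2
  lt_gap : 2 * δ < (ρ - ‖R‖) ^ 2

theorem eventually_isThin (hR : 0 < R 2) (hρ : ‖R‖ < ρ) : ∀ᶠ δ in 𝓝[>] (0 : ℝ), IsThin R ρ δ := by
  have h1 : (0 : ℝ) < R 2 ^ 2 / 2 := by positivity
  have h2 : (0 : ℝ) < (ρ - ‖R‖) ^ 2 / 2 := by have := sub_pos.2 hρ; positivity
  filter_upwards [self_mem_nhdsWithin, nhdsWithin_le_nhds (Iio_mem_nhds one_pos),
    nhdsWithin_le_nhds (Iio_mem_nhds h1), nhdsWithin_le_nhds (Iio_mem_nhds h2)] with δ a b c d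
  simp only [mem_Iio] at b c d
  exact ⟨a, b.le, by linarith, by linarith⟩

/-- Where the inner profile is not locally `1`, the outer profile is `1` and one is in the
half-space. -/
theorem IsThin.of_norm_sub_sq_le (h : IsThin R ρ δ) (hR : 0 < R 2) (hρ : ‖R‖ < ρ) {x : Space}
    (hx : ‖x - R‖ ^ 2 ≤ 2 * δ) : x ∈ upperSpace ∧ ‖x‖ ^ 2 < ρ ^ 2 := by
  have h1 : ‖x - R‖ < R 2 := by
    refine lt_of_pow_lt_pow_left₀ 2 hR.le (hx.trans_lt h.lt_height)
  have h2 : ‖x - R‖ < ρ - ‖R‖ :=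
    lt_of_pow_lt_pow_left₀ 2 (sub_pos.2 hρ).le (hx.trans_lt h.lt_gap)
  have h3 := PiLp.norm_apply_le (x - R) 2
  rw [PiLp.sub_apply, Real.norm_eq_abs] at h3
  have h4 := norm_sub_norm_le x R
  refine ⟨?_, pow_lt_pow_left₀ (by linarith) (norm_nonneg _) two_ne_zero⟩
  have := (abs_lt.1 (h3.trans_lt h1)).1
  simp only [upperSpace, mem_ofPred_eq]
  linarith

/-- Green's identity with the two cut-offs, in polar coordinates. -/
theorem IsThin.weighted_identity (h : IsThin R ρ δ) (hR : 0 < R 2) (hρ : ‖R‖ < ρ)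
    (hV : ContDiff ℝ 2 V) (hΔ : ∀ x : Space, 0 ≤ x 2 → ‖x‖ ≤ ρ + 1 →
      Laplacian.laplacian V x + (k : ℂ) ^ 2 * V x = 0) :
    IntegrableOn (fun r => ((2 * r * deriv (outerProfile ρ δ) (r ^ 2) : ℝ) : ℂ) *
      capFlux k R V r) (Ioi 0) ∧
    IntegrableOn (fun r => ((2 * r * deriv (innerProfile δ) (r ^ 2) : ℝ) : ℂ) *
      sphereFlux k R V r) (Ioi 0) ∧
    (∫ r in Ioi (0 : ℝ), ((2 * r * deriv (outerProfile ρ δ) (r ^ 2) : ℝ) : ℂ) *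
      capFlux k R V r) +
    (∫ r in Ioi (0 : ℝ), ((2 * r * deriv (innerProfile δ) (r ^ 2) : ℝ) : ℂ) *
      sphereFlux k R V r) =
    -∫ p : ℝ × ℝ, (outerProfile ρ δ (‖planePoint p‖ ^ 2) : ℂ) *
      hkDensity k R V (planePoint p) (basisVec 2) := by
  have hδ := h.pos
  have hρ0 : 0 ≤ ρ := (norm_nonneg R).trans hρ.le
  set ho := outerProfile ρ δ
  set hi := innerProfile δ
  have hoc : ContDiff ℝ 1 ho := contDiff_outerProfile ρ δ
  have hic : ContDiff ℝ 1 hi := contDiff_innerProfile δ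
  -- As `δ ≤ 1`, the cut-off lives in the ball of radius `ρ + 1`, where the Helmholtz equation is
  -- assumed on `z ≥ 0`.
  have hbound : ∀ x : Space, ‖x‖ ^ 2 ≤ ρ ^ 2 + δ → ‖x‖ ≤ ρ + 1 := fun x hx => by
    refine le_of_sq_le_sq ?_ (by linarith)
    nlinarith [h.le_one]
  have hout : ∀ x : Space, deriv ho (‖x‖ ^ 2) ≠ 0 → ρ ^ 2 ≤ ‖x‖ ^ 2 ∧ ‖x‖ ^ 2 ≤ ρ ^ 2 + δ :=
    fun x hx => mem_Icc_of_deriv_outerProfile_ne_zero hδ hx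
  have hin : ∀ x : Space, deriv hi (‖x - R‖ ^ 2) ≠ 0 → ‖x - R‖ ^ 2 ≤ 2 * δ :=
    fun x hx => (mem_Icc_of_deriv_innerProfile_ne_zero hδ hx).2
  have hone : ∀ x : Space, ¬ (x ∈ upperSpace ∧ ‖x‖ ^ 2 < ρ ^ 2) → hi (‖x - R‖ ^ 2) = 1 :=
    fun x hx => innerProfile_eq_one hδ (by
      by_contra! hlt
      exact hx (h.of_norm_sub_sq_le hR hρ hlt.le))
  have hnear : ∀ᶠ x in 𝓝 R, ‖x - R‖ ^ 2 < δ := by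
    have : ContinuousAt (fun x : Space => ‖x - R‖ ^ 2) R := by fun_prop
    exact this.eventually_lt_const (by simpa using hδ)
  have hwo_c : HasCompactSupport fun x : Space => 2 * deriv ho (‖x‖ ^ 2) := by
    refine HasCompactSupport.intro (isCompact_closedBall (0 : Space) (ρ + 1)) fun x hx => ?_
    by_contra hne
    exact hx (by simpa using hbound x (hout x (right_ne_zero_of_mul hne)).2)
  have hwo_R : (fun x : Space => 2 * deriv ho (‖x‖ ^ 2)) =ᶠ[𝓝 R] fun _ => 0 := by
    filter_upwards [isOpen_ball.mem_nhds (by simpa using hρ : R ∈ ball (0 : Space) ρ)] with x hx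
    by_contra hne
    have h1 := (hout x (right_ne_zero_of_mul hne)).1
    have h2 : ‖x‖ < ρ := by simpa using hx
    exact absurd h1 (not_le.2 (pow_lt_pow_left₀ h2 (norm_nonneg _) two_ne_zero))
  have hwi_c : HasCompactSupport fun x : Space => 2 * deriv hi (‖x - R‖ ^ 2) := by
    refine HasCompactSupport.intro (isCompact_closedBall (0 : Space) (ρ + 1)) fun x hx => ?_
    by_contra hne
    refine hx ?_
    have := (h.of_norm_sub_sq_le hR hρ (hin x (right_ne_zero_of_mul hne))).2
    simpa using hbound x (by linarith)
  have hwi_R : (fun x : Space => 2 * deriv hi (‖x - R‖ ^ 2)) =ᶠ[𝓝 R] fun _ => 0 := by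
    filter_upwards [hnear] with x hx
    by_contra hne
    exact absurd (mem_Icc_of_deriv_innerProfile_ne_zero hδ (right_ne_zero_of_mul hne)).1
      (not_le.2 hx)
  obtain ⟨hA, hA'⟩ := integral_cap_weight (k := k) hV hoc hwo_c hwo_R
  obtain ⟨hB, hB'⟩ := integral_sphere_weight (k := k) hV hic hwi_c hwi_R
  refine ⟨hA, hB, ?_⟩
  rw [← hA', ← hB']
  set χ : Space → ℝ := fun x => ho (‖x‖ ^ 2) * hi (‖x - R‖ ^ 2)
  have hoc' : ContDiff ℝ 1 fun x : Space => ho (‖x‖ ^ 2) := by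
    simpa using contDiff_profile_norm_sq hoc 0
  have hχ : ContDiff ℝ 1 χ := hoc'.mul (contDiff_profile_norm_sq hic R)
  have hχ0 : ∀ x, χ x ≠ 0 → ‖x‖ ≤ ρ + 1 := fun x hx => by
    by_contra hgt
    refine left_ne_zero_of_mul hx (outerProfile_eq_zero hδ ?_)
    by_contra! hlt
    exact hgt (hbound x hlt.le)
  have hχc : HasCompactSupport χ :=
    HasCompactSupport.intro (isCompact_closedBall (0 : Space) (ρ + 1)) fun x hx => by
      by_contra hne
      exact hx (by simpa using hχ0 x hne)
  have hχR : χ =ᶠ[𝓝 R] fun _ => 0 := by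
    filter_upwards [hnear] with x hx
    simp only [χ]
    rw [show hi (‖x - R‖ ^ 2) = 0 from innerProfile_eq_zero hδ hx.le, mul_zero]
  set G : Space → Space := fun x => (2 * deriv ho (‖x‖ ^ 2)) • x +
    (2 * deriv hi (‖x - R‖ ^ 2)) • (x - R) with hGdef
  have hG : ∀ x, HasFDerivAt χ (innerSL ℝ (G x)) x := by
    intro x
    have h1 : HasFDerivAt (fun y : Space => ho (‖y‖ ^ 2))
        (innerSL ℝ ((2 * deriv ho (‖x‖ ^ 2)) • x)) x := by
      simpa using hasFDerivAt_profile_norm_sq hoc 0 x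
    refine (h1.mul (hasFDerivAt_profile_norm_sq hic R x)).congr_fderiv ?_
    -- Wherever one profile varies the other equals `1`, so the gradient of the product is the sum
    -- of the two gradients.
    have e1 : hi (‖x - R‖ ^ 2) * (2 * deriv ho (‖x‖ ^ 2)) = 2 * deriv ho (‖x‖ ^ 2) := by
      by_cases h0 : deriv ho (‖x‖ ^ 2) = 0
      · simp [h0]
      · rw [hone x fun hx => absurd (hout x h0).1 (not_le.2 hx.2), one_mul]
    have e2 : ho (‖x‖ ^ 2) * (2 * deriv hi (‖x - R‖ ^ 2)) = 2 * deriv hi (‖x - R‖ ^ 2) := by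
      by_cases h0 : deriv hi (‖x - R‖ ^ 2) = 0
      · simp [h0]
      · rw [show ho (‖x‖ ^ 2) = 1 from
          outerProfile_eq_one hδ (h.of_norm_sub_sq_le hR hρ (hin x h0)).2.le, one_mul]
    rw [← map_smul, ← map_smul, smul_smul, smul_smul, e1, e2, ← map_add, add_comm]
  have hmain := setIntegral_upperSpace_hkDensity_gradient (k := k) hV hχ hχc hχR hG
    fun x hx hx0 => hΔ x (le_of_lt hx) (hχ0 x hx0)
  -- The inner shell lies inside the half-space, so its integral may be taken over all of space, as
  -- polar coordinates about `R` require.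
  have hsupp : ∫ x, hkDensity k R V x ((2 * deriv hi (‖x - R‖ ^ 2)) • (x - R)) =
      ∫ x in upperSpace, hkDensity k R V x ((2 * deriv hi (‖x - R‖ ^ 2)) • (x - R)) := by
    refine (setIntegral_eq_integral_of_forall_compl_eq_zero fun x hx => ?_).symm
    by_cases h0 : deriv hi (‖x - R‖ ^ 2) = 0
    · simp [h0, hkDensity]
    · exact absurd (h.of_norm_sub_sq_le hR hρ (hin x h0)).1 hx
  have i1 : Integrable fun x => hkDensity k R V x ((2 * deriv ho (‖x‖ ^ 2)) • x) := by
    simpa using integrable_hkDensity_of_hasCompactSupport (k := k) hV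
      (continuous_const.mul ((hoc.continuous_deriv le_rfl).comp (continuous_norm.pow 2)))
      hwo_c hwo_R 0
  have i2 : Integrable fun x => hkDensity k R V x ((2 * deriv hi (‖x - R‖ ^ 2)) • (x - R)) :=
    integrable_hkDensity_of_hasCompactSupport (k := k) hV
    (continuous_const.mul ((hic.continuous_deriv le_rfl).comp
      ((continuous_id.sub continuous_const).norm.pow 2))) hwi_c hwi_R R
  rw [hsupp, ← integral_add i1.integrableOn i2.integrableOn]
  simp only [hGdef, hkDensity_add] at hmain
  rw [hmain]
  congr 2
  ext p
  simp only [χ]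
  rw [hone (planePoint p) fun hp => by simpa [upperSpace, planePoint] using hp.1, mul_one]

end Cutoff

/-! ### Letting the thickness of the cut-offs tend to zero. -/

section Limit

variable {k ρ : ℝ} {R : Space} {V : Space → ℂ}

theorem toSphere_real_univ : (volume : Measure Space).toSphere.real univ = 4 * Real.pi := by
  rw [Measure.toSphere_real_apply_univ, measureReal_def, EuclideanSpace.volume_ball_fin_three]
  have h : 0 ≤ Real.pi * 4 / 3 := by positivity
  simp only [ENNReal.ofReal_one, one_pow, one_mul, ENNReal.toReal_ofReal h,
    finrank_euclideanSpace, Fintype.card_fin]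
  push_cast
  ring

/-- The flux through a small sphere, in a form that is regular at radius zero. -/
theorem sphereFlux_eq_integral {r : ℝ} (hr : 0 < r) :
    sphereFlux k R V r = ∫ ω : sphere (0 : Space) 1, (Complex.exp (-(Complex.I * k * r)) *
      (r * fderiv ℝ V (r • (ω : Space) + R) (ω : Space) +
        V (r • (ω : Space) + R) * (Complex.I * k * r + 1)))
      ∂((volume : Measure Space).toSphere) := by
  rw [sphereFlux, ← integral_const_mul]
  refine integral_congr_ae (Eventually.of_forall fun ω => ?_)
  have hω : ‖(ω : Space)‖ = 1 := by simp
  have hn : ‖r • (ω : Space)‖ = r := by rw [norm_smul, hω, mul_one, Real.norm_of_nonneg hr.le]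
  have hne : r • (ω : Space) ≠ 0 := norm_pos_iff.1 (hn.symm ▸ hr : 0 < ‖r • (ω : Space)‖)
  have hr' : (r : ℂ) ≠ 0 := by exact_mod_cast hr.ne'
  simp only [hkDensity, fderiv_green_sub, add_sub_cancel_right]
  rw [fderiv_green_apply k hne, hn, real_inner_smul_left, real_inner_self_eq_norm_sq, hω, green, hn,
    gradCoeff]
  push_cast
  field_simp
  ring

/-- After the area factor `r²` cancels the singularity, the integrand is jointly continuous up to `r
= 0`, where it is the constant `V R` on a sphere of area `4π`. -/
theorem tendsto_sphereFlux (hV : ContDiff ℝ 2 V) :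
    Tendsto (sphereFlux k R V) (𝓝[>] 0) (𝓝 (4 * Real.pi * V R)) := by
  set Ψ : ℝ → sphere (0 : Space) 1 → ℂ := fun r ω => Complex.exp (-(Complex.I * k * r)) *
      (r * fderiv ℝ V (r • (ω : Space) + R) (ω : Space) +
        V (r • (ω : Space) + R) * (Complex.I * k * r + 1)) with hΨ
  have hcont : Continuous (Function.uncurry Ψ) := by
    have h1 : Continuous fun p : ℝ × sphere (0 : Space) 1 => p.1 • (p.2 : Space) + R := by fun_prop
    have h2 : Continuous fun p : ℝ × sphere (0 : Space) 1 =>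
        fderiv ℝ V (p.1 • (p.2 : Space) + R) (p.2 : Space) :=
      ((hV.continuous_fderiv two_ne_zero).comp h1).clm_apply (by fun_prop)
    have h3 := hV.continuous.comp h1
    have h4 : Continuous fun p : ℝ × sphere (0 : Space) 1 => (p.1 : ℂ) :=
      Complex.continuous_ofReal.comp continuous_fst
    exact (Complex.continuous_exp.comp (continuous_const.mul h4).neg).mul
      ((h4.mul h2).add (h3.mul ((continuous_const.mul h4).add continuous_const)))
  have hint := continuous_parametric_integral_of_continuous
    (μ := (volume : Measure Space).toSphere) hcont isCompact_univ
  simp only [Measure.restrict_univ] at hint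
  have h0 : ∫ ω, Ψ 0 ω ∂(volume : Measure Space).toSphere = 4 * Real.pi * V R := by
    simp only [hΨ, Complex.ofReal_zero, mul_zero, neg_zero, Complex.exp_zero, zero_mul, zero_smul,
      zero_add, mul_one, one_mul, integral_const, toSphere_real_univ, Complex.real_smul]
    push_cast
    ring
  rw [← h0]
  refine (hint.tendsto 0).mono_left nhdsWithin_le_nhds |>.congr' ?_
  filter_upwards [self_mem_nhdsWithin] with r hr
  exact (sphereFlux_eq_integral hr).symm

theorem continuousAt_capFlux (hV : ContDiff ℝ 2 V) (hρ : ‖R‖ < ρ) :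
    ContinuousAt (capFlux k R V) ρ := by
  -- Radii are restricted to a subtype so that the sphere never meets `R` and the integrand is
  -- continuous everywhere.
  have hcont : Continuous (Function.uncurry fun (r : Ioi ‖R‖) (ω : sphere (0 : Space) 1) =>
      hkDensity k R V ((r : ℝ) • (ω : Space)) (ω : Space)) := by
    refine continuous_iff_continuousAt.2 fun p => ?_
    refine continuousAt_hkDensity hV (f := fun q : Ioi ‖R‖ × sphere (0 : Space) 1 =>
      (q.1 : ℝ) • (q.2 : Space)) (by fun_prop) (by fun_prop) fun h => ?_
    have h1 := congrArg norm h
    have h2 : ‖R‖ < (p.1 : ℝ) := p.1.2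
    rw [norm_smul, Real.norm_of_nonneg ((norm_nonneg R).trans h2.le)] at h1
    simp at h1
    linarith
  have : LocallyCompactSpace (Ioi ‖R‖) := isOpen_Ioi.locallyCompactSpace
  have hint := continuous_parametric_integral_of_continuous
    (μ := (volume : Measure Space).toSphere.restrict upperSphere) hcont isCompact_univ
  simp only [Measure.restrict_univ] at hint
  have hon : ContinuousOn (capFlux k R V) (Ioi ‖R‖) := by
    rw [continuousOn_iff_continuous_domRestrict]
    exact ((Complex.continuous_ofReal.comp continuous_subtype_val).pow 2).mul hint
  exact hon.continuousAt (Ioi_mem_nhds hρ)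

theorem norm_planePoint_sq (p : ℝ × ℝ) : ‖planePoint p‖ ^ 2 = p.1 ^ 2 + p.2 ^ 2 := by
  rw [EuclideanSpace.norm_sq_eq]
  simp [planePoint, Fin.sum_univ_three]

theorem mem_disc_iff {p : ℝ × ℝ} : p ∈ disc ρ ↔ ‖planePoint p‖ ^ 2 ≤ ρ ^ 2 := by
  rw [norm_planePoint_sq, disc, mem_ofPred_eq]

theorem continuous_planePoint : Continuous planePoint := by
  unfold planePoint
  fun_prop

theorem isCompact_disc (ρ : ℝ) : IsCompact (disc ρ) := by
  have hclosed : IsClosed (disc ρ) := isClosed_le (by fun_prop) continuous_const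
  refine (isCompact_Icc (a := ((-|ρ|, -|ρ|) : ℝ × ℝ)) (b := (|ρ|, |ρ|))).of_isClosed_subset
    hclosed fun p hp => ?_
  have hp' : p.1 ^ 2 + p.2 ^ 2 ≤ ρ ^ 2 := hp
  have h1 := abs_le.1 (sq_le_sq.1 (show p.1 ^ 2 ≤ ρ ^ 2 by nlinarith [sq_nonneg p.2]))
  have h2 := abs_le.1 (sq_le_sq.1 (show p.2 ^ 2 ≤ ρ ^ 2 by nlinarith [sq_nonneg p.1]))
  exact ⟨⟨h1.1, h2.1⟩, h1.2, h2.2⟩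

theorem normal_eq_basisVec : normal = basisVec 2 := by
  ext j
  fin_cases j <;> simp [normal, basisVec]

theorem continuous_hkDensity_planePoint (hV : ContDiff ℝ 2 V) (hR : 0 < R 2) (ν : Space) :
    Continuous fun p => hkDensity k R V (planePoint p) ν := by
  refine continuous_iff_continuousAt.2 fun p => continuousAt_hkDensity hV
    continuous_planePoint.continuousAt continuousAt_const fun h => hR.ne ?_
  rw [← h]
  simp [planePoint]

/-- Dominated convergence: the profile tends pointwise to the indicator of the closed disc. The sign
of the limit reflects the outward normal `-normal` in `flatFlux`. -/
theorem tendsto_integral_outerProfile (hV : ContDiff ℝ 2 V) (hR : 0 < R 2) (hρ : 0 ≤ ρ) :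
    Tendsto (fun δ => ∫ p : ℝ × ℝ, (outerProfile ρ δ (‖planePoint p‖ ^ 2) : ℂ) *
      hkDensity k R V (planePoint p) (basisVec 2)) (𝓝[>] 0) (𝓝 (-flatFlux k R V (disc ρ))) := by
  have hc := continuous_hkDensity_planePoint (k := k) hV hR (basisVec 2)
  have hlim : -flatFlux k R V (disc ρ) =
      ∫ p, (disc ρ).indicator (fun p => hkDensity k R V (planePoint p) (basisVec 2)) p := by
    rw [integral_indicator (isCompact_disc ρ).measurableSet, flatFlux, normal_eq_basisVec]
    simp only [hkDensity_neg, integral_neg, neg_neg]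
  rw [hlim]
  refine tendsto_integral_filter_of_dominated_convergence
    ((disc (ρ + 1)).indicator fun p => ‖hkDensity k R V (planePoint p) (basisVec 2)‖) ?_ ?_ ?_ ?_
  · refine Eventually.of_forall fun δ => Continuous.aestronglyMeasurable ?_
    have h1 := (contDiff_outerProfile ρ δ).continuous.comp (continuous_planePoint.norm.pow 2)
    exact (Complex.continuous_ofReal.comp h1).mul hc
  · filter_upwards [self_mem_nhdsWithin, nhdsWithin_le_nhds (Iio_mem_nhds one_pos)] with δ hδ hδ1
    refine Eventually.of_forall fun p => ?_
    rw [norm_mul, Complex.norm_real]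
    by_cases hp : p ∈ disc (ρ + 1)
    · rw [indicator_of_mem hp]
      refine mul_le_of_le_one_left (norm_nonneg _) ?_
      rw [outerProfile, Real.norm_of_nonneg (Real.smoothTransition.nonneg _)]
      exact Real.smoothTransition.le_one _
    · rw [indicator_of_notMem hp, outerProfile_eq_zero hδ, norm_zero, zero_mul]
      rw [mem_disc_iff, not_le] at hp
      have hδ1' : δ < 1 := hδ1
      nlinarith
  · rw [integrable_indicator_iff (isCompact_disc _).measurableSet]
    exact hc.norm.continuousOn.integrableOn_compact (isCompact_disc _)
  · refine Eventually.of_forall fun p => ?_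
    refine tendsto_const_nhds.congr' ?_
    by_cases hp : p ∈ disc ρ
    · filter_upwards [self_mem_nhdsWithin] with δ hδ
      rw [indicator_of_mem hp, outerProfile_eq_one hδ (mem_disc_iff.1 hp), Complex.ofReal_one,
        one_mul]
    · have hpos : 0 < ‖planePoint p‖ ^ 2 - ρ ^ 2 := by
        rw [mem_disc_iff, not_le] at hp
        linarith
      filter_upwards [self_mem_nhdsWithin, nhdsWithin_le_nhds (Iio_mem_nhds hpos)] with δ hδ hδ'
      have : δ < ‖planePoint p‖ ^ 2 - ρ ^ 2 := hδ'
      rw [indicator_of_notMem hp, outerProfile_eq_zero hδ (by linarith), Complex.ofReal_zero,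
        zero_mul]

/-- The Helmholtz–Kirchhoff formula for a globally smooth field that solves the Helmholtz equation
in a half-ball. -/
theorem flatFlux_add_capFlux (hV : ContDiff ℝ 2 V) (hR : 0 < R 2) (hρ : ‖R‖ < ρ)
    (hΔ : ∀ x : Space, 0 ≤ x 2 → ‖x‖ ≤ ρ + 1 →
      Laplacian.laplacian V x + (k : ℂ) ^ 2 * V x = 0) :
    flatFlux k R V (disc ρ) + capFlux k R V ρ = 4 * Real.pi * V R := by
  have hρ0 : 0 < ρ := (norm_nonneg R).trans_lt hρ
  have hthin := eventually_isThin hR hρ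
  -- The outer profile decreases from `1` to `0`, so minus its derivative is the probability
  -- density.
  have hA : Tendsto (fun δ => ∫ r in Ioi (0 : ℝ),
      ((-(2 * r * deriv (outerProfile ρ δ) (r ^ 2)) : ℝ) : ℂ) * capFlux k R V r)
      (𝓝[>] 0) (𝓝 (capFlux k R V ρ)) := by
    refine tendsto_integral_of_concentrating_weight measurableSet_Ioi ?_ ?_ ?_ ?_ ?_
    · filter_upwards [self_mem_nhdsWithin] with δ hδ r hr
      have := deriv_outerProfile_nonpos (ρ := ρ) (s := r ^ 2) hδ
      have hr' : 0 < r := hr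
      nlinarith [mul_nonneg hr'.le (neg_nonneg.2 this)]
    · filter_upwards [self_mem_nhdsWithin] with δ hδ
      exact (integrableOn_and_integral_radial_weight (contDiff_outerProfile ρ δ)
        fun s hs => outerProfile_eq_zero hδ hs).1.neg
    · filter_upwards [self_mem_nhdsWithin] with δ hδ
      rw [integral_neg, (integrableOn_and_integral_radial_weight (contDiff_outerProfile ρ δ)
        fun s hs => outerProfile_eq_zero hδ hs).2, outerProfile_eq_one hδ (sq_nonneg ρ)]
      norm_num
    · filter_upwards [hthin] with δ hδ
      refine (hδ.weighted_identity hR hρ hV hΔ).1.neg.congr (Eventually.of_forall fun r => ?_)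
      simp
    · intro ε hε
      obtain ⟨d, hd, hdist⟩ := Metric.continuousAt_iff.1 (continuousAt_capFlux (k := k) hV hρ) ε hε
      filter_upwards [self_mem_nhdsWithin, nhdsWithin_le_nhds (Iio_mem_nhds (mul_pos hd hρ0))]
        with δ hδ hδ' r hr hne
      have hδ1 : δ < d * ρ := hδ'
      have hr' : 0 < r := hr
      obtain ⟨h1, h2⟩ := mem_Icc_of_deriv_outerProfile_ne_zero hδ
        (right_ne_zero_of_mul (neg_ne_zero.1 hne))
      have h3 : ρ ≤ r := le_of_sq_le_sq h1 hr'.le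
      rw [← dist_eq_norm]
      refine (hdist ?_).le
      rw [Real.dist_eq, abs_of_nonneg (sub_nonneg.2 h3)]
      -- This uses `(r - ρ) ρ ≤ r² - ρ² ≤ δ < d ρ`.
      have h4 : (r - ρ) * ρ < d * ρ := by nlinarith [mul_nonneg (sub_nonneg.2 h3) hr'.le]
      exact lt_of_mul_lt_mul_right h4 hρ0.le
  have hB : Tendsto (fun δ => ∫ r in Ioi (0 : ℝ),
      ((2 * r * deriv (innerProfile δ) (r ^ 2) : ℝ) : ℂ) * sphereFlux k R V r)
      (𝓝[>] 0) (𝓝 (4 * Real.pi * V R)) := by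
    refine tendsto_integral_of_concentrating_weight measurableSet_Ioi ?_ ?_ ?_ ?_ ?_
    · filter_upwards [self_mem_nhdsWithin] with δ hδ r hr
      have hr' : 0 < r := hr
      exact mul_nonneg (by positivity) (deriv_innerProfile_nonneg hδ)
    · filter_upwards [self_mem_nhdsWithin] with δ hδ
      exact (integrableOn_and_integral_radial_weight (contDiff_innerProfile δ)
        fun s hs => innerProfile_eq_one hδ hs).1
    · filter_upwards [self_mem_nhdsWithin] with δ hδ
      rw [(integrableOn_and_integral_radial_weight (contDiff_innerProfile δ)
        fun s hs => innerProfile_eq_one hδ hs).2, innerProfile_eq_zero hδ (le_of_lt hδ), sub_zero]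
    · filter_upwards [hthin] with δ hδ
      exact (hδ.weighted_identity hR hρ hV hΔ).2.1
    · intro ε hε
      obtain ⟨d, hd, hdist⟩ := Metric.tendsto_nhdsWithin_nhds.1
        (tendsto_sphereFlux (k := k) (R := R) hV) ε hε
      have hd2 : (0 : ℝ) < d ^ 2 / 2 := by positivity
      filter_upwards [self_mem_nhdsWithin, nhdsWithin_le_nhds (Iio_mem_nhds hd2)]
        with δ hδ hδ' r hr hne
      have hδ1 : δ < d ^ 2 / 2 := hδ'
      have hr' : 0 < r := hr
      have h2 := (mem_Icc_of_deriv_innerProfile_ne_zero hδ (right_ne_zero_of_mul hne)).2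
      rw [← dist_eq_norm]
      refine (hdist hr ?_).le
      rw [Real.dist_eq, sub_zero, abs_of_pos hr']
      exact lt_of_pow_lt_pow_left₀ 2 hd.le (by linarith)
  have hD := tendsto_integral_outerProfile (k := k) hV hR hρ0.le
  have hsum := (hB.sub hA).add hD
  -- For thin cut-offs the combined expression is identically zero, so its limit, sphere minus cap
  -- minus disc, is zero as well.
  have hzero : Tendsto (fun _ => (0 : ℂ)) (𝓝[>] (0 : ℝ)) (𝓝 _) := hsum.congr' <| by
    filter_upwards [hthin] with δ hδ
    have h1 := (hδ.weighted_identity hR hρ hV hΔ).2.2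
    have h2 : (∫ r in Ioi (0 : ℝ),
        ((-(2 * r * deriv (outerProfile ρ δ) (r ^ 2)) : ℝ) : ℂ) * capFlux k R V r) =
        -∫ r in Ioi (0 : ℝ),
        ((2 * r * deriv (outerProfile ρ δ) (r ^ 2) : ℝ) : ℂ) * capFlux k R V r := by
      rw [← integral_neg]
      simp
    rw [h2, sub_neg_eq_add]
    linear_combination h1
  have := tendsto_nhds_unique tendsto_const_nhds hzero
  linear_combination this

end Limit

/-! ### The Helmholtz–Kirchhoff formula for fields on the closed half-space. -/

section HelmholtzKirchhoff

variable {k ρ : ℝ} {R : Space}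

/-- `U` is multiplied by a bump function that is `1` near `C` and vanishes outside a compact set of
points where `U` is `C²`. Agreement on neighbourhoods preserves all derivatives on `C`. -/
theorem exists_contDiff_extension {U : Space → ℂ} {C : Set Space} (hC : IsCompact C)
    (hU : ∀ x ∈ C, ContDiffAt ℝ 2 U x) :
    ∃ V : Space → ℂ, ContDiff ℝ 2 V ∧ ∀ x ∈ C, V =ᶠ[𝓝 x] U := by
  have hO : IsOpen {x | ContDiffAt ℝ 2 U x} :=
    isOpen_iff_eventually.2 fun x (hx : ContDiffAt ℝ 2 U x) => hx.eventually (by simp)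
  obtain ⟨K, hK, hCK, hKO⟩ := exists_compact_between hC hO hU
  obtain ⟨f, hf1, hf0, -⟩ := exists_contMDiffMap_one_nhds_of_subset_interior (n := 2)
    𝓘(ℝ, Space) hC.isClosed hCK
  have hf : ContDiff ℝ 2 f := f.contMDiff.contDiff
  refine ⟨fun x => f x • U x, contDiff_iff_contDiffAt.2 fun x => ?_, fun x hx => ?_⟩
  · by_cases hx : x ∈ K
    · exact hf.contDiffAt.smul (hKO hx)
    · refine contDiffAt_const (c := (0 : ℂ)) |>.congr_of_eventuallyEq ?_
      filter_upwards [hK.isClosed.isOpen_compl.mem_nhds hx] with y hy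
      rw [hf0 y hy, zero_smul]
  · filter_upwards [hf1.filter_mono (nhds_le_nhdsSet hx)] with y hy
    rw [hy, one_smul]

theorem hkDensity_congr {U V : Space → ℂ} {x : Space} (h : V =ᶠ[𝓝 x] U) (ν : Space) :
    hkDensity k R V x ν = hkDensity k R U x ν := by
  rw [hkDensity, hkDensity, h.fderiv_eq, h.eq_of_nhds]

theorem hkIntegral_eq_of_isHelmholtz {U : Space → ℂ} (hU : IsHelmholtz k U) (hR : 0 < R 2)
    (hρ : ‖R‖ < ρ) {S : Set (ℝ × ℝ)} (hS : MeasurableSet S) (hSρ : S ⊆ disc ρ) :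
    hkIntegral k R S U U U ρ = U R := by
  have hρ0 : 0 < ρ := (norm_nonneg R).trans_lt hρ
  have hC : IsCompact {x : Space | 0 ≤ x 2 ∧ ‖x‖ ≤ ρ + 1} := by
    refine (isCompact_closedBall (0 : Space) (ρ + 1)).of_isClosed_subset ?_ fun x hx => by
      simpa using hx.2
    have hc : Continuous fun x : Space => x 2 := by fun_prop
    exact (isClosed_le continuous_const hc).inter (isClosed_le continuous_norm continuous_const)
  obtain ⟨V, hV, hVU⟩ := exists_contDiff_extension hC fun x hx => (hU x hx.1).1
  have hΔ : ∀ x : Space, 0 ≤ x 2 → ‖x‖ ≤ ρ + 1 →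
      Laplacian.laplacian V x + (k : ℂ) ^ 2 * V x = 0 := fun x hx hx' => by
    have h := hVU x ⟨hx, hx'⟩
    rw [(InnerProductSpace.laplacian_congr_nhds h).eq_of_nhds, h.eq_of_nhds]
    exact (hU x hx).2
  have hmain := flatFlux_add_capFlux hV hR hρ hΔ
  have hdisc : ∀ p ∈ disc ρ, hkDensity k R U (planePoint p) (-normal) =
      hkDensity k R V (planePoint p) (-normal) := fun p hp => by
    refine (hkDensity_congr (hVU _ ⟨by simp [planePoint], ?_⟩) _).symm
    have := le_of_sq_le_sq (mem_disc_iff.1 hp) hρ0.le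
    linarith
  have hflat : ∀ D ⊆ disc ρ, MeasurableSet D → flatFlux k R U D = flatFlux k R V D :=
    fun D hD hDm => setIntegral_congr_fun hDm fun p hp => hdisc p (hD hp)
  have hcap : capFlux k R U ρ = capFlux k R V ρ := by
    rw [capFlux_eq, capFlux_eq]
    congr 1
    refine setIntegral_congr_fun measurableSet_upperSphere fun ω hω => ?_
    refine (hkDensity_congr (hVU _ ⟨?_, ?_⟩) _).symm
    · simpa using mul_nonneg hρ0.le (le_of_lt hω)
    · simp [norm_smul, abs_of_pos hρ0]
  have hint : IntegrableOn (fun p => hkDensity k R V (planePoint p) (-normal)) (disc ρ) :=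
    (continuous_hkDensity_planePoint hV hR _).continuousOn.integrableOn_compact (isCompact_disc ρ)
  have hsplit : flatFlux k R V S + flatFlux k R V (disc ρ \ S) = flatFlux k R V (disc ρ) := by
    have := setIntegral_union disjoint_sdiff_right ((isCompact_disc ρ).measurableSet.diff hS)
      (hint.mono_set hSρ) (hint.mono_set sdiff_subset)
    rw [union_sdiff_cancel hSρ] at this
    exact this.symm
  have hUR : V R = U R := (hVU R ⟨hR.le, by linarith⟩).eq_of_nhds
  rw [hkIntegral, hcap, hflat S hSρ hS,
    hflat _ sdiff_subset ((isCompact_disc ρ).measurableSet.diff hS), hsplit, hmain, hUR]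
  have : (Real.pi : ℂ) ≠ 0 := by exact_mod_cast Real.pi_ne_zero
  field_simp

/-! ### The contribution of the hemisphere at infinity. -/

theorem norm_hkDensity_le_of_isRadiating {V : Space → ℂ} (hV : IsRadiating k V) (R : Space) :
    ∀ ε > 0, ∀ᶠ r : ℝ in atTop, ∀ ω : Space, ‖ω‖ = 1 → 0 < ω 2 →
      ‖hkDensity k R V (r • ω) ω‖ ≤ ε / r ^ 2 := by
  intro ε hε
  obtain ⟨-, ⟨C, r₁, hC⟩, hS⟩ := hV
  obtain ⟨r₂, hr₂⟩ := hS (ε / 4) (by positivity)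
  obtain ⟨D, hD0, hD⟩ := exists_sommerfeld_bound k R
  filter_upwards [eventually_ge_atTop r₁, eventually_ge_atTop r₂,
    eventually_ge_atTop (2 * ‖R‖ + 1), eventually_gt_atTop 0,
    eventually_ge_atTop (2 * (|C| * D) / ε)] with r h1 h2 h3 h0 h4 ω hω hω2
  have hn : ‖r • ω‖ = r := by rw [norm_smul, hω, mul_one, Real.norm_of_nonneg h0.le]
  have hpos : 0 < (r • ω) 2 := by simpa using mul_pos h0 hω2
  have hu : ‖r • ω‖⁻¹ • r • ω = ω := by rw [hn, smul_smul, inv_mul_cancel₀ h0.ne', one_smul]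
  have b1 := hC (r • ω) hpos (hn.symm ▸ h1)
  have b2 := hr₂ (r • ω) hpos (hn.symm ▸ h2)
  obtain ⟨b3, b4⟩ := hD (r • ω) (hn.symm ▸ h3)
  rw [hu] at b2 b4
  rw [hn] at b1 b2 b3 b4
  -- Adding and subtracting `j k V g` puts a Sommerfeld combination in each product: `o(1/r) ·
  -- O(1/r)` for `V`, and `O(1/r) · O(1/r²)` for the Green function.
  have hid : hkDensity k R V (r • ω) ω =
      (fderiv ℝ V (r • ω) ω + Complex.I * k * V (r • ω)) * green k (r • ω - R) -
      V (r • ω) * (fderiv ℝ (fun z => green k (z - R)) (r • ω) ω +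
        Complex.I * k * green k (r • ω - R)) := by
    rw [hkDensity]
    ring
  have b2' : ‖fderiv ℝ V (r • ω) ω + Complex.I * k * V (r • ω)‖ ≤ ε / 4 / r := by
    rw [le_div_iff₀ h0]
    linarith
  have b1' : ‖V (r • ω)‖ ≤ |C| / r := b1.trans (by gcongr; exact le_abs_self C)
  rw [div_le_iff₀ hε] at h4
  rw [hid]
  calc _ ≤ ε / 4 / r * (2 / r) + |C| / r * (D / r ^ 2) := by
        refine (norm_sub_le _ _).trans ?_
        rw [norm_mul, norm_mul]
        gcongr
    _ ≤ ε / 2 / r ^ 2 + ε / 2 / r ^ 2 := by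
        refine add_le_add (le_of_eq (by field_simp; norm_num)) ?_
        rw [div_mul_div_comm, div_le_div_iff₀ (by positivity) (by positivity)]
        nlinarith [sq_nonneg r]
    _ = ε / r ^ 2 := by ring

theorem tendsto_capFlux_of_isRadiating {V : Space → ℂ} (hV : IsRadiating k V) (R : Space) :
    Tendsto (capFlux k R V) atTop (𝓝 0) := by
  rw [Metric.tendsto_nhds]
  intro ε hε
  have hpi := Real.pi_pos
  filter_upwards [norm_hkDensity_le_of_isRadiating hV R (ε / (8 * Real.pi)) (by positivity),
    eventually_gt_atTop 0] with r hr h0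
  rw [dist_zero_right, capFlux_eq, norm_mul, norm_pow, Complex.norm_real,
    Real.norm_of_nonneg h0.le]
  have h1 : ‖∫ ω in upperSphere, hkDensity k R V (r • (ω : Space)) (ω : Space)
      ∂((volume : Measure Space).toSphere)‖ ≤
      ε / (8 * Real.pi) / r ^ 2 * (volume : Measure Space).toSphere.real upperSphere :=
    norm_setIntegral_le_of_norm_le_const (measure_lt_top _ _)
      fun ω hω => hr ω (by simp) hω
  have h2 : (volume : Measure Space).toSphere.real upperSphere ≤ 4 * Real.pi :=
    toSphere_real_univ ▸ measureReal_mono (subset_univ _)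
  calc _ ≤ r ^ 2 * (ε / (8 * Real.pi) / r ^ 2 * (4 * Real.pi)) := by
        gcongr
        exact h1.trans (by gcongr)
    _ = ε / 2 := by field_simp; norm_num
    _ < ε := half_lt_self hε

/-- The patch term does not depend on `ρ`, the rest of the disc carries the zero field, and the cap
term tends to zero whatever `V` is. -/
theorem tendsto_hkIntegral_of_isRadiating {V : Space → ℂ} (hV : IsRadiating k V) (R : Space)
    (S : Set (ℝ × ℝ)) (W : Space → ℂ) :
    Tendsto (fun ρ => hkIntegral k R S W (fun _ => 0) V ρ) atTop
      (𝓝 (1 / (4 * (Real.pi : ℂ)) * flatFlux k R W S)) := by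
  have h0 : ∀ D, flatFlux k R (fun _ => 0) D = 0 := fun D => by simp [flatFlux, hkDensity]
  simp only [hkIntegral, h0, add_zero]
  have := (tendsto_capFlux_of_isRadiating hV R).const_add (flatFlux k R W S)
  rw [add_zero] at this
  exact this.const_mul _

/-! ### The explicit integrand on the patch. -/

theorem cosNormal_eq (v : Space) : cosNormal v = v 2 / ‖v‖ := by
  have hn : ‖normal‖ = 1 := by simp [normal_eq_basisVec, basisVec]
  rw [cosNormal, InnerProductGeometry.cos_angle, hn, mul_one, normal_eq_basisVec]
  simp [basisVec, PiLp.inner_apply]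

theorem incVec_apply_two (T : Space) (p : ℝ × ℝ) : incVec T p 2 = -T 2 := by
  simp [incVec, planePoint]

theorem refVec_apply_two (R : Space) (p : ℝ × ℝ) : refVec R p 2 = R 2 := by
  simp [refVec, planePoint]

theorem incVec_ne_zero {T : Space} (hT : 0 < T 2) (p : ℝ × ℝ) : incVec T p ≠ 0 := fun h => by
  have := incVec_apply_two T p
  rw [h] at this
  simp at this
  linarith

theorem refVec_ne_zero {R : Space} (hR : 0 < R 2) (p : ℝ × ℝ) : refVec R p ≠ 0 := fun h => by
  have := refVec_apply_two R p
  rw [h] at this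
  simp at this
  linarith

theorem mirror_planePoint (p : ℝ × ℝ) : mirror (planePoint p) = planePoint p := by
  ext j
  fin_cases j <;> simp [mirror, planePoint]

theorem reflectedWave_planePoint (k : ℝ) (T : Space) (Γ A : ℂ) (p : ℝ × ℝ) :
    reflectedWave k T Γ A (planePoint p) = Γ * incidentWave k T A (planePoint p) := by
  rw [reflectedWave, mirror_planePoint]

theorem gradCoeff_mul_norm (k : ℝ) {v : Space} (hv : v ≠ 0) :
    gradCoeff k ‖v‖ * ‖v‖ = -(Complex.I * k + 1 / ‖v‖) * green k v := by
  have hr : (‖v‖ : ℂ) ≠ 0 := by simpa using hv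
  rw [gradCoeff, green]
  field_simp

theorem gradCoeff_mul_apply_two (k : ℝ) {v : Space} (hv : v ≠ 0) :
    gradCoeff k ‖v‖ * (v 2 : ℂ) = -(Complex.I * k + 1 / ‖v‖) * green k v * cosNormal v := by
  have hr : (‖v‖ : ℂ) ≠ 0 := by simpa using hv
  rw [← gradCoeff_mul_norm k hv, cosNormal_eq]
  push_cast
  field_simp

/-- On the plane the image source is as far away as `T`, and the component along `-normal` of the
vector from the image equals the `z`-component of `incVec`; this fixes the sign of the incident
cosine. -/
theorem hkDensity_reflectedWave_planePoint (k : ℝ) {T R : Space} (hT : 0 < T 2) (hR : 0 < R 2)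
    (Γ A : ℂ) (p : ℝ × ℝ) :
    hkDensity k R (reflectedWave k T Γ A) (planePoint p) (-normal) =
      Γ * A * (green k (incVec T p) * green k (refVec R p) *
        ((Complex.I * k + 1 / (‖refVec R p‖ : ℂ)) * cosNormal (refVec R p) -
          (Complex.I * k + 1 / (‖incVec T p‖ : ℂ)) * cosNormal (incVec T p))) := by
  have hi := incVec_ne_zero hT p
  have hr := refVec_ne_zero hR p
  have hni : ‖planePoint p - mirror T‖ = ‖incVec T p‖ := by
    rw [← norm_mirror_sub, mirror_planePoint, incVec]
  have hnr : ‖planePoint p - R‖ = ‖refVec R p‖ := by rw [refVec, norm_sub_rev]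
  have hi' : planePoint p - mirror T ≠ 0 := norm_ne_zero_iff.1 (hni ▸ norm_ne_zero_iff.2 hi)
  have hr' : planePoint p - R ≠ 0 := norm_ne_zero_iff.1 (hnr ▸ norm_ne_zero_iff.2 hr)
  have hd : DifferentiableAt ℝ (fun x => green k (x - mirror T)) (planePoint p) :=
    (contDiffAt_green_sub k (n := 1) (sub_ne_zero.1 hi')).differentiableAt one_ne_zero
  have e1 : (⟪planePoint p - mirror T, -normal⟫ : ℝ) = incVec T p 2 := by
    rw [incVec_apply_two, inner_neg_right, normal_eq_basisVec]
    simp [basisVec, PiLp.inner_apply, planePoint, mirror]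
  have e2 : (⟪planePoint p - R, -normal⟫ : ℝ) = refVec R p 2 := by
    rw [refVec_apply_two, inner_neg_right, normal_eq_basisVec]
    simp [basisVec, PiLp.inner_apply, planePoint]
  have g1 : green k (planePoint p - mirror T) = green k (incVec T p) := by
    rw [green, green, hni]
  have g2 : green k (planePoint p - R) = green k (refVec R p) := by
    rw [green, green, hnr]
  rw [hkDensity, reflectedWave_eq, fderiv_const_smul hd]
  simp only [smul_apply, Pi.smul_apply, smul_eq_mul, fderiv_green_sub]
  rw [fderiv_green_apply k hi', fderiv_green_apply k hr', e1, e2, hni, hnr, g1, g2,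
    gradCoeff_mul_apply_two k hi, gradCoeff_mul_apply_two k hr]
  ring

theorem flatFlux_reflectedWave (k : ℝ) {T R : Space} (hT : 0 < T 2) (hR : 0 < R 2)
    (Γ A : ℂ) (S : Set (ℝ × ℝ)) :
    flatFlux k R (reflectedWave k T Γ A) S =
      Γ * A * ∫ p in S, green k (incVec T p) * green k (refVec R p) *
        ((Complex.I * k + 1 / (‖refVec R p‖ : ℂ)) * cosNormal (refVec R p) -
          (Complex.I * k + 1 / (‖incVec T p‖ : ℂ)) * cosNormal (incVec T p)) := by
  rw [flatFlux, ← integral_const_mul]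
  simp only [hkDensity_reflectedWave_planePoint k hT hR]

theorem continuous_incVec (T : Space) : Continuous (incVec T) :=
  continuous_planePoint.sub continuous_const

theorem continuous_refVec (R : Space) : Continuous (refVec R) :=
  continuous_const.sub continuous_planePoint

theorem continuous_green_comp (k : ℝ) {v : ℝ × ℝ → Space} (hv : Continuous v)
    (h0 : ∀ p, v p ≠ 0) : Continuous fun p => green k (v p) :=
  continuous_iff_continuousAt.2 fun p =>
    (contDiffAt_green k (n := 0) (h0 p)).continuousAt.comp hv.continuousAt

theorem continuous_cosNormal_comp {v : ℝ × ℝ → Space} (hv : Continuous v)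
    (h0 : ∀ p, v p ≠ 0) : Continuous fun p => cosNormal (v p) := by
  simp only [cosNormal_eq]
  exact Continuous.div (by fun_prop) hv.norm fun p => norm_ne_zero_iff.2 (h0 p)

theorem continuous_inv_norm_comp {v : ℝ × ℝ → Space} (hv : Continuous v)
    (h0 : ∀ p, v p ≠ 0) : Continuous fun p => 1 / (‖v p‖ : ℂ) :=
  continuous_const.div (Complex.continuous_ofReal.comp hv.norm) fun p => by simpa using h0 p

/-! ### The far-field error bound. -/

/-- The near-field terms are dominated by the far-field ones, because the two cosines have opposite
signs. -/
theorem norm_nearField_le {T R : Space} (hT : 0 < T 2) (hR : 0 < R 2) {k ε : ℝ} {p : ℝ × ℝ}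
    (hi : 1 / ‖incVec T p‖ ≤ ε * k) (hr : 1 / ‖refVec R p‖ ≤ ε * k) (c : ℂ) :
    ‖c * ((1 / ‖refVec R p‖ * cosNormal (refVec R p) -
      1 / ‖incVec T p‖ * cosNormal (incVec T p) : ℝ) : ℂ)‖ ≤
      ε * k * ‖c * ((cosNormal (refVec R p) - cosNormal (incVec T p) : ℝ) : ℂ)‖ := by
  have h1 : 0 ≤ cosNormal (refVec R p) := by
    rw [cosNormal_eq, refVec_apply_two]
    positivity
  have h2 : 0 ≤ -cosNormal (incVec T p) := by
    rw [cosNormal_eq, incVec_apply_two, neg_div, neg_neg]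
    positivity
  have h3 : 0 ≤ 1 / ‖refVec R p‖ := by positivity
  have h4 : 0 ≤ 1 / ‖incVec T p‖ := by positivity
  rw [norm_mul, norm_mul, Complex.norm_real, Complex.norm_real,
    Real.norm_of_nonneg (by nlinarith [mul_nonneg h3 h1, mul_nonneg h4 h2]),
    Real.norm_of_nonneg (by linarith), mul_left_comm]
  refine mul_le_mul_of_nonneg_left ?_ (norm_nonneg _)
  nlinarith [mul_le_mul_of_nonneg_right hr h1, mul_le_mul_of_nonneg_right hi h2]

theorem norm_farField_error_le {T R : Space} (hT : 0 < T 2) (hR : 0 < R 2) (Γ A : ℂ)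
    {S : Set (ℝ × ℝ)} (hS : IsCompact S) {k ε : ℝ}
    (hε : ∀ p ∈ S, 1 / ‖incVec T p‖ ≤ ε * k ∧ 1 / ‖refVec R p‖ ≤ ε * k) :
    ‖Γ * A / (4 * (Real.pi : ℂ)) *
        (∫ p in S, green k (incVec T p) * green k (refVec R p) *
          ((Complex.I * k + 1 / (‖refVec R p‖ : ℂ)) * cosNormal (refVec R p) -
            (Complex.I * k + 1 / (‖incVec T p‖ : ℂ)) * cosNormal (incVec T p))) -
      Complex.I * k * Γ * A / (4 * (Real.pi : ℂ)) *
        ∫ p in S, green k (incVec T p) * green k (refVec R p) *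
          ((cosNormal (refVec R p) - cosNormal (incVec T p) : ℝ) : ℂ)‖ ≤
      ε * (k * ‖Γ‖ * ‖A‖ / (4 * Real.pi) *
        ∫ p in S, ‖green k (incVec T p) * green k (refVec R p) *
          ((cosNormal (refVec R p) - cosNormal (incVec T p) : ℝ) : ℂ)‖) := by
  have hi0 := incVec_ne_zero hT
  have hr0 := refVec_ne_zero hR
  have ci := continuous_incVec T
  have cr := continuous_refVec R
  have hg := (continuous_green_comp k ci hi0).mul (continuous_green_comp k cr hr0)
  have hci := continuous_cosNormal_comp ci hi0
  have hcr := continuous_cosNormal_comp cr hr0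
  have hF : Continuous fun p => green k (incVec T p) * green k (refVec R p) *
      ((cosNormal (refVec R p) - cosNormal (incVec T p) : ℝ) : ℂ) :=
    hg.mul (Complex.continuous_ofReal.comp (hcr.sub hci))
  have hE : Continuous fun p => green k (incVec T p) * green k (refVec R p) *
      ((Complex.I * k + 1 / (‖refVec R p‖ : ℂ)) * cosNormal (refVec R p) -
        (Complex.I * k + 1 / (‖incVec T p‖ : ℂ)) * cosNormal (incVec T p)) :=
    hg.mul (((continuous_const.add (continuous_inv_norm_comp cr hr0)).mul
      (Complex.continuous_ofReal.comp hcr)).sub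
      ((continuous_const.add (continuous_inv_norm_comp ci hi0)).mul
        (Complex.continuous_ofReal.comp hci)))
  have iF := hF.continuousOn.integrableOn_compact (μ := volume) hS
  have iE := hE.continuousOn.integrableOn_compact (μ := volume) hS
  -- The `j k` terms cancel exactly; only the `1/r` terms remain to be estimated.
  have hdiff : Γ * A / (4 * (Real.pi : ℂ)) *
        (∫ p in S, green k (incVec T p) * green k (refVec R p) *
          ((Complex.I * k + 1 / (‖refVec R p‖ : ℂ)) * cosNormal (refVec R p) -
            (Complex.I * k + 1 / (‖incVec T p‖ : ℂ)) * cosNormal (incVec T p))) -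
      Complex.I * k * Γ * A / (4 * (Real.pi : ℂ)) *
        (∫ p in S, green k (incVec T p) * green k (refVec R p) *
          ((cosNormal (refVec R p) - cosNormal (incVec T p) : ℝ) : ℂ)) =
      Γ * A / (4 * (Real.pi : ℂ)) * ∫ p in S, green k (incVec T p) * green k (refVec R p) *
        ((1 / ‖refVec R p‖ * cosNormal (refVec R p) -
          1 / ‖incVec T p‖ * cosNormal (incVec T p) : ℝ) : ℂ) := by
    rw [show ∀ x y : ℂ, Γ * A / (4 * (Real.pi : ℂ)) * x -
      Complex.I * k * Γ * A / (4 * (Real.pi : ℂ)) * y =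
      Γ * A / (4 * (Real.pi : ℂ)) * (x - Complex.I * k * y) from fun x y => by ring,
      ← integral_const_mul, ← integral_sub iE (iF.const_mul _)]
    congr 2
    ext p
    push_cast
    ring
  rw [hdiff, norm_mul]
  have hpref : ‖Γ * A / (4 * (Real.pi : ℂ))‖ = ‖Γ‖ * ‖A‖ / (4 * Real.pi) := by
    rw [norm_div, norm_mul, norm_mul, Complex.norm_real, Real.norm_of_nonneg Real.pi_pos.le]
    norm_num
  rw [hpref]
  have hle : ‖∫ p in S, green k (incVec T p) * green k (refVec R p) *
        ((1 / ‖refVec R p‖ * cosNormal (refVec R p) -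
          1 / ‖incVec T p‖ * cosNormal (incVec T p) : ℝ) : ℂ)‖ ≤
      ∫ p in S, ε * k * ‖green k (incVec T p) * green k (refVec R p) *
          ((cosNormal (refVec R p) - cosNormal (incVec T p) : ℝ) : ℂ)‖ := by
    refine norm_integral_le_of_norm_le (iF.norm.const_mul _) ?_
    filter_upwards [ae_restrict_mem hS.measurableSet] with p hp
    exact norm_nearField_le hT hR (hε p hp).1 (hε p hp).2 _
  rw [integral_const_mul] at hle
  calc _ ≤ ‖Γ‖ * ‖A‖ / (4 * Real.pi) * _ :=
        mul_le_mul_of_nonneg_left hle (by have := Real.pi_pos; positivity)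
    _ = _ := by ring

end HelmholtzKirchhoff

end RIS

end

theorem theorem2 (lam k : ℝ) (hlam : 0 < lam) (hk : k = 2 * Real.pi / lam)
    (a b : ℝ) (ha : 0 < a) (hb : 0 < b)
    (M N m n : ℕ) (hm : m ∈ Finset.Icc 1 M) (hn : n ∈ Finset.Icc 1 N)
    (T R : RIS.Space) (hT : 0 < T 2) (hR : 0 < R 2) (Γ A : ℂ)
    (S : Set (ℝ × ℝ)) (hS : S = RIS.patch a b M N m n) :
    -- Helmholtz–Kirchhoff: the closed-surface integral of a field is its value at the receiver
    (∀ U : RIS.Space → ℂ, RIS.IsHelmholtz k U →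
      ∀ ρ : ℝ, ‖R‖ < ρ → S ⊆ RIS.disc ρ → RIS.hkIntegral k R S U U U ρ = U R) ∧
    -- the reflected wave is an outgoing field, and is `Γ` times the incident field on the surface
    RIS.IsHelmholtz k (RIS.reflectedWave k T Γ A) ∧
    RIS.IsRadiating k (RIS.reflectedWave k T Γ A) ∧
    (∀ p : ℝ × ℝ, RIS.reflectedWave k T Γ A (RIS.planePoint p) =
      Γ * RIS.incidentWave k T A (RIS.planePoint p)) ∧
    -- the field `E` reflected by the patch `S`
    ∃ E : ℂ,
      (∀ V : RIS.Space → ℂ, RIS.IsRadiating k V →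
        Filter.Tendsto
          (fun ρ : ℝ => RIS.hkIntegral k R S (RIS.reflectedWave k T Γ A) (fun _ => 0) V ρ)
          Filter.atTop (nhds E)) ∧
      E = 1 / (4 * (Real.pi : ℂ)) * RIS.flatFlux k R (RIS.reflectedWave k T Γ A) S ∧
      E = Γ * A / (4 * (Real.pi : ℂ)) *
        ∫ p in S, RIS.green k (RIS.incVec T p) * RIS.green k (RIS.refVec R p) *
          ((Complex.I * k + 1 / (‖RIS.refVec R p‖ : ℂ)) * RIS.cosNormal (RIS.refVec R p) -
            (Complex.I * k + 1 / (‖RIS.incVec T p‖ : ℂ)) * RIS.cosNormal (RIS.incVec T p)) ∧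
      ∀ ε : ℝ,
        (∀ p ∈ S, 1 / ‖RIS.incVec T p‖ ≤ ε * k ∧ 1 / ‖RIS.refVec R p‖ ≤ ε * k) →
        ‖E - Complex.I * k * Γ * A / (4 * (Real.pi : ℂ)) *
            ∫ p in S, RIS.green k (RIS.incVec T p) * RIS.green k (RIS.refVec R p) *
              ((RIS.cosNormal (RIS.refVec R p) - RIS.cosNormal (RIS.incVec T p) : ℝ) : ℂ)‖ ≤
          ε * (k * ‖Γ‖ * ‖A‖ / (4 * Real.pi) *
            ∫ p in S, ‖RIS.green k (RIS.incVec T p) * RIS.green k (RIS.refVec R p) *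
              ((RIS.cosNormal (RIS.refVec R p) - RIS.cosNormal (RIS.incVec T p) : ℝ) : ℂ)‖) := by
  have hSc : IsCompact S := hS ▸ isCompact_Icc.prod isCompact_Icc
  refine ⟨fun U hU ρ hρ hSρ =>
      RIS.hkIntegral_eq_of_isHelmholtz hU hR hρ hSc.measurableSet hSρ,
    RIS.isHelmholtz_reflectedWave k hT Γ A, RIS.isRadiating_reflectedWave k hT Γ A,
    -- The witness is read off from the limit lemma, whose limit does not mention `V`; it is the
    -- patch integral itself, hence the `rfl` that follows.
    RIS.reflectedWave_planePoint k T Γ A, _,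
    fun V hV => RIS.tendsto_hkIntegral_of_isRadiating hV R S _, rfl, ?_, fun ε hε => ?_⟩
  · rw [RIS.flatFlux_reflectedWave k hT hR]
    ring
  · have h := RIS.norm_farField_error_le hT hR Γ A hSc hε
    rw [RIS.flatFlux_reflectedWave k hT hR, ← mul_assoc, one_div_mul_eq_div]
    exact h
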